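/- Let $k\ge 1$ and ${\bf n}=(n_1,\dots,n_k)\in\mathbb N^k$. For $i=1,\dots,k$ let $\mathbb F_{n_i}^+$ be the unital free semigroup on $g^i_1,\dots,g^i_{n_i}$, and for $q\ge 0$ put $\Gamma_q:=\{\boldsymbol\alpha=(\alpha_1,\dots,\alpha_k)\in\mathbb F_{n_1}^+\times\cdots\times\mathbb F_{n_k}^+:\ |\alpha_1|+\cdots+|\alpha_k|=q\}$, where $|\cdot|$ is the word length. For a tuple ${\bf X}=(X_{i,j})_{1\le i\le k,\,1\le j\le n_i}$ of bounded operators on a complex Hilbert space $\mathcal H$ put $X_{i,w}:=X_{i,j_1}\cdots X_{i,j_p}$ if $w=g^i_{j_1}\cdots g^i_{j_p}$, with the empty word giving $I$, and ${\bf X}_{\boldsymbol\alpha}:=X_{1,\alpha_1}\cdots X_{k,\alpha_k}$. The regular polyball ${\bf B_n}(\mathcal H)$ is the set of all ${\bf X}$ such that $X_{s,a}$ commutes with $X_{t,b}$ whenever $s\ne t$, $\|\sum_j X_{i,j}X_{i,j}^*\|<1$ for every $i$, and $(\mathrm{id}-\Phi_{X_1})\circ\cdots\circ(\mathrm{id}-\Phi_{X_k})(I)$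 is positive and invertible, where $\Phi_{X_i}(Y):=\sum_j X_{i,j}YX_{i,j}^*$. The universal model ${\bf S}=\{{\bf S}_{i,j}\}$ consists of the operators on the Hilbert tensor product $F^2(H_{n_1})\otimes\cdots\otimes F^2(H_{n_k})$ of full Fock spaces that act as the left creation operator $e_\alpha\mapsto e_{g_j\alpha}$ on the $i$-th factor and as the identity on the others. Let $\omega(T):=\sup\{|\langle Th,h\rangle|:\ \|h\|=1\}$ be the numerical radius. Let $\mathcal K$ be a Hilbert space. A function $F$ assigning to each separable Hilbert space $\mathcal H$ and each ${\bf X}\in{\bf B_n}(\mathcal H)$ an operator $F({\bf X})\in B(\mathcal K\otimes\mathcal H)$ is called free $k$-pluriharmonic if there are coefficients $C_{(\boldsymbol\alpha;\boldsymbol\beta)}\in B(\mathcal K)$ with $$F({\bf X})=\sum_{{\bf p}\in\mathbb Z^k}\ \sum_{|\alpha_i|=p_i^-,\ |\beta_i|=p_i^+}C_{(\boldsymbol\alpha;\boldsymbol\beta)}\otimes X_{1,\alpha_1}\cdots X_{k,\alpha_k}X_{1,\beta_1}^*\cdots X_{k,\beta_k}^*,$$ the multi-series converging in operator norm, regardless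 of the order, at every such ${\bf X}$; it is positive if $F({\bf X})\ge 0$ for every such ${\bf X}$. **Theorem.** Let $m\in\mathbb N\cup\{\infty\}$ and let $$f({\bf X})=\sum_{q=1}^m\sum_{\boldsymbol\alpha\in\Gamma_q}A_{(\boldsymbol\alpha)}^*\otimes{\bf X}_{\boldsymbol\alpha}^*+A_0\otimes I+\sum_{q=1}^m\sum_{\boldsymbol\alpha\in\Gamma_q}A_{(\boldsymbol\alpha)}\otimes{\bf X}_{\boldsymbol\alpha}$$ be a positive free $k$-pluriharmonic function on the polyball with coefficients $A_0,A_{(\boldsymbol\alpha)}\in B(\mathcal K)$ (for $m=\infty$ both series over $q$ converge in operator norm). Then for every $q\in\mathbb N$ with $q\le m$, every Hilbert space $\mathcal H$ and every ${\bf X}\in{\bf B_n}(\mathcal H)$, $$\omega\Big(\sum_{\boldsymbol\alpha\in\Gamma_q}A_{(\boldsymbol\alpha)}\otimes{\bf X}_{\boldsymbol\alpha}\Big)\le\omega\Big(\sum_{\boldsymbol\alpha\in\Gamma_q}A_{(\boldsymbol\alpha)}\otimes{\bf S}_{\boldsymbol\alpha}\Big).$$ If $m\in\mathbb N$, then for every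 $q\in\{1,\dots,m\}$, $$\omega\Big(\sum_{\boldsymbol\alpha\in\Gamma_q}A_{(\boldsymbol\alpha)}\otimes{\bf S}_{\boldsymbol\alpha}\Big)\le\|A_0\|\cos\frac{\pi}{[m/q]+2},$$ where $[x]$ is the integer part of $x$. If $m=\infty$, then for every $q\in\mathbb N$, $$\omega\Big(\sum_{\boldsymbol\alpha\in\Gamma_q}A_{(\boldsymbol\alpha)}\otimes{\bf S}_{\boldsymbol\alpha}\Big)\le\|A_0\|.$$ -/

import Mathlib

open scoped TensorProduct

noncomputable section

namespace NCPolyball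

/-! ### Hilbert tensor products and the numerical radius -/

/-- The Hilbert space tensor product of `K` and `H`: the completion of the algebraic tensor
product for the inner product `⟪x ⊗ y, x' ⊗ y'⟫ = ⟪x, x'⟫ ⟪y, y'⟫`. -/
abbrev HilbertTensor (K H : Type*) [NormedAddCommGroup K] [InnerProductSpace ℂ K]
    [NormedAddCommGroup H] [InnerProductSpace ℂ H] : Type _ :=
  UniformSpace.Completion (K ⊗[ℂ] H)

/-- The bounded operator `A ⊗ T` on the Hilbert tensor product, the continuous extension of
`x ⊗ y ↦ A x ⊗ T y`. -/
def tensorOp {K H : Type*} [NormedAddCommGroup K] [InnerProductSpace ℂ K]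
    [NormedAddCommGroup H] [InnerProductSpace ℂ H] (A : K →L[ℂ] K) (T : H →L[ℂ] H) :
    HilbertTensor K H →L[ℂ] HilbertTensor K H :=
  (TensorProduct.mapL A T).completion

/-- The numerical radius `ω(T) = sup {|⟨T h, h⟩| : ‖h‖ = 1}` (equal to `0` on the zero space). -/
def numericalRadius {H : Type*} [NormedAddCommGroup H] [InnerProductSpace ℂ H]
    (T : H →L[ℂ] H) : ℝ :=
  sSup {x : ℝ | ∃ h : H, ‖h‖ = 1 ∧ x = ‖inner ℂ (T h) h‖}

/-! ### Multi-words -/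

/-- Elements `α = (α₁, …, α_k)` of the product of the free semigroups with unit on `n₁, …, n_k`
generators. -/
abbrev MultiWord {k : ℕ} (n : Fin k → ℕ) : Type := (i : Fin k) → FreeMonoid (Fin (n i))

/-- Only finitely many multi-words have all their lengths bounded. -/
theorem finite_multiWord_length_le {k : ℕ} (n : Fin k → ℕ) (q : ℕ) :
    {α : MultiWord n | ∀ i, (α i).length ≤ q}.Finite := by
  have h : ∀ i : Fin k, {w : FreeMonoid (Fin (n i)) | w.length ≤ q}.Finite :=
    fun i => List.finite_length_le (Fin (n i)) q
  exact (Set.Finite.pi' h)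

theorem finite_totalLength {k : ℕ} (n : Fin k → ℕ) (q : ℕ) :
    {α : MultiWord n | ∑ i, (α i).length = q}.Finite :=
  (finite_multiWord_length_le n q).subset fun α (hα : ∑ i, (α i).length = q) i =>
    hα ▸ Finset.single_le_sum (f := fun i => (α i).length) (fun _ _ => Nat.zero_le _)
      (Finset.mem_univ i)

theorem finite_multiLength {k : ℕ} (n : Fin k → ℕ) (p : Fin k → ℕ) :
    {α : MultiWord n | ∀ i, (α i).length = p i}.Finite :=
  (finite_multiWord_length_le n (∑ i, p i)).subset fun α (hα : ∀ i, (α i).length = p i) i =>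
    (hα i).le.trans (Finset.single_le_sum (fun _ _ => Nat.zero_le _) (Finset.mem_univ i))

/-- `Γ_q`, the multi-words `α` with `|α₁| + ⋯ + |α_k| = q`. -/
def Gam {k : ℕ} (n : Fin k → ℕ) (q : ℕ) : Finset (MultiWord n) :=
  (finite_totalLength n q).toFinset

/-- `Λ_p`, the multi-words `α` with `|α_i| = p_i` for every `i`. -/
def Lam {k : ℕ} (n : Fin k → ℕ) (p : Fin k → ℕ) : Finset (MultiWord n) :=
  (finite_multiLength n p).toFinset

/-! ### Tuples of operators and the regular polyball -/

/-- Tuples `X = (X₁, …, X_k)` with `X_i = (X_{i,1}, …, X_{i,n_i})` of bounded operators on `H`. -/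
abbrev OpTuple {k : ℕ} (n : Fin k → ℕ) (H : Type*) [NormedAddCommGroup H]
    [InnerProductSpace ℂ H] : Type _ :=
  (i : Fin k) → Fin (n i) → (H →L[ℂ] H)

section Tuples

variable {k : ℕ} {n : Fin k → ℕ} {H : Type*} [NormedAddCommGroup H] [InnerProductSpace ℂ H]

/-- `X_{i,w} = X_{i,j₁} ⋯ X_{i,j_p}` for the word `w = g_{j₁} ⋯ g_{j_p}`. -/
def OpTuple.word (X : OpTuple n H) (i : Fin k) (w : FreeMonoid (Fin (n i))) : H →L[ℂ] H :=
  FreeMonoid.lift (X i) w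

/-- `X_α = X_{1,α₁} ⋯ X_{k,α_k}`. -/
def OpTuple.monomial (X : OpTuple n H) (α : MultiWord n) : H →L[ℂ] H :=
  ((List.finRange k).map fun i => X.word i (α i)).prod

variable [CompleteSpace H]

/-- `X_{1,β₁}^* ⋯ X_{k,β_k}^*`. -/
def OpTuple.adjMonomial (X : OpTuple n H) (β : MultiWord n) : H →L[ℂ] H :=
  ((List.finRange k).map fun i => (X.word i (β i)).adjoint).prod

/-- The completely positive map `Φ_{X_i}(Y) = ∑_j X_{i,j} Y X_{i,j}^*`. -/
def OpTuple.phi (X : OpTuple n H) (i : Fin k) : Module.End ℂ (H →L[ℂ] H) :=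
  ∑ j, LinearMap.mulLeft ℂ (X i j) ∘ₗ LinearMap.mulRight ℂ (X i j).adjoint

/-- The defect map `Δ_X = (id - Φ_{X_1}) ∘ ⋯ ∘ (id - Φ_{X_k})`. -/
def OpTuple.defect (X : OpTuple n H) : Module.End ℂ (H →L[ℂ] H) :=
  ((List.finRange k).map fun i => LinearMap.id - X.phi i).prod

variable (n H) in
/-- The regular polyball `B_n(H)`: the entries of `X_s` commute with those of `X_t` for `s ≠ t`,
each `X_i` is a strict row contraction, and `Δ_X(I)` is positive and invertible. -/
def regularPolyball : Set (OpTuple n H) :=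
  {X | (∀ s t : Fin k, s ≠ t → ∀ a b, Commute (X s a) (X t b)) ∧
    (∀ i, ‖∑ j, X i j * (X i j).adjoint‖ < 1) ∧
    (X.defect 1).IsPositive ∧ IsUnit (X.defect 1)}

end Tuples

/-! ### The universal model -/

/-- The Hilbert tensor product `F²(H_{n₁}) ⊗ ⋯ ⊗ F²(H_{n_k})` of full Fock spaces, realized as
`ℓ²` with orthonormal basis `e_α = e_{α₁} ⊗ ⋯ ⊗ e_{α_k}` indexed by the multi-words. -/
abbrev FockSpace {k : ℕ} (n : Fin k → ℕ) : Type :=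
  lp (fun _ : MultiWord n => ℂ) 2

open scoped Classical in
/-- The basis vector `e_α`. -/
def fockBasis {k : ℕ} (n : Fin k → ℕ) (α : MultiWord n) : FockSpace n :=
  lp.single 2 α (1 : ℂ)

/-- `α ↦ (α₁, …, g_j α_i, …, α_k)`. -/
def consWord {k : ℕ} {n : Fin k → ℕ} (i : Fin k) (j : Fin (n i)) (α : MultiWord n) :
    MultiWord n :=
  Function.update α i (FreeMonoid.of j * α i)

theorem consWord_injective {k : ℕ} {n : Fin k → ℕ} (i : Fin k) (j : Fin (n i)) :
    Function.Injective (consWord (n := n) i j) := by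
  intro α β h
  funext l
  have hl := congrFun h l
  by_cases hli : l = i
  · subst hli
    simpa [consWord] using hl
  · simpa [consWord, hli] using hl

theorem orthonormal_fockBasis {k : ℕ} (n : Fin k → ℕ) : Orthonormal ℂ (fockBasis n) := by
  classical
  rw [orthonormal_iff_ite]
  intro α β
  rw [fockBasis, lp.inner_single_left]
  by_cases h : α = β
  · subst h
    simp [fockBasis]
  · simp [fockBasis, h]

/-- The operator `S_{i,j}`: it acts as the left creation operator by `e_j` on the `i`-th Fock space
and as the identity on the others, that is, `S_{i,j} e_α = e_{(α₁, …, g_j α_i, …, α_k)}`. -/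
def creation {k : ℕ} (n : Fin k → ℕ) (i : Fin k) (j : Fin (n i)) :
    FockSpace n →L[ℂ] FockSpace n :=
  ((orthonormal_fockBasis n).comp _
    (consWord_injective i j)).orthogonalFamily.linearIsometry.toContinuousLinearMap

theorem creation_fockBasis {k : ℕ} (n : Fin k → ℕ) (i : Fin k) (j : Fin (n i))
    (α : MultiWord n) : creation n i j (fockBasis n α) = fockBasis n (consWord i j α) := by
  simp [creation, fockBasis]

/-- The universal model `S = {S_{i,j}}` of the polyball. -/
def universalModel {k : ℕ} (n : Fin k → ℕ) : OpTuple n (FockSpace n) := creation n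

/-! ### Free pluriharmonic functions with operator coefficients -/

/-- A function that assigns to each tuple `X` of operators on a Hilbert space `H` an operator on
`K ⊗ H`. (Only its values on the polyballs of separable Hilbert spaces are used; up to unitary
equivalence, every separable Hilbert space lives in `Type`.) -/
abbrev FreeFunction {k : ℕ} (n : Fin k → ℕ) (K : Type*) [NormedAddCommGroup K]
    [InnerProductSpace ℂ K] : Type _ :=
  (H : Type) → [NormedAddCommGroup H] → [InnerProductSpace ℂ H] → [CompleteSpace H] →
    OpTuple n H → (HilbertTensor K H →L[ℂ] HilbertTensor K H)

section Functions

variable {k : ℕ} {n : Fin k → ℕ} {K : Type*} [NormedAddCommGroup K] [InnerProductSpace ℂ K]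

/-- `∑_{α ∈ Γ_q} A_α ⊗ X_α`. -/
def homPart {H : Type*} [NormedAddCommGroup H] [InnerProductSpace ℂ H]
    (A : MultiWord n → (K →L[ℂ] K)) (X : OpTuple n H) (q : ℕ) :
    HilbertTensor K H →L[ℂ] HilbertTensor K H :=
  ∑ α ∈ Gam n q, tensorOp (A α) (X.monomial α)

/-- `∑_{α ∈ Γ_q} A_α^* ⊗ X_α^*`. -/
def coHomPart [CompleteSpace K] {H : Type*} [NormedAddCommGroup H] [InnerProductSpace ℂ H]
    [CompleteSpace H] (A : MultiWord n → (K →L[ℂ] K)) (X : OpTuple n H) (q : ℕ) :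
    HilbertTensor K H →L[ℂ] HilbertTensor K H :=
  ∑ α ∈ Gam n q, tensorOp (A α).adjoint (X.monomial α).adjoint

/-- The term of multi-degree `p ∈ ℤ^k` of a free `k`-pluriharmonic series, with
`p^+ = max p 0` and `p^- = max (-p) 0`:
`∑_{|α_i| = p_i^-, |β_i| = p_i^+} C_{α;β} ⊗ X_{1,α₁} ⋯ X_{k,α_k} X_{1,β₁}^* ⋯ X_{k,β_k}^*`. -/
def pluriTerm {H : Type*} [NormedAddCommGroup H] [InnerProductSpace ℂ H] [CompleteSpace H]
    (C : MultiWord n → MultiWord n → (K →L[ℂ] K)) (X : OpTuple n H) (p : Fin k → ℤ) :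
    HilbertTensor K H →L[ℂ] HilbertTensor K H :=
  ∑ α ∈ Lam n (fun i => (-p i).toNat), ∑ β ∈ Lam n (fun i => (p i).toNat),
    tensorOp (C α β) (X.monomial α * X.adjMonomial β)

/-- `F` is a free `k`-pluriharmonic function on the abstract polyball with coefficients in `B(K)`:
it is the sum of a `k`-pluriharmonic multi-series that converges in the operator norm
(regardless of the order) at every point of every regular polyball. -/
def IsFreePluriharmonic (F : FreeFunction n K) : Prop :=
  ∃ C : MultiWord n → MultiWord n → (K →L[ℂ] K),
    ∀ (H : Type) [NormedAddCommGroup H] [InnerProductSpace ℂ H] [CompleteSpace H]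
      [TopologicalSpace.SeparableSpace H], ∀ X ∈ regularPolyball n H,
        HasSum (pluriTerm C X) (F H X)

/-- `F(X) ≥ 0` at every point of every regular polyball. -/
def IsPositiveOnPolyball (F : FreeFunction n K) : Prop :=
  ∀ (H : Type) [NormedAddCommGroup H] [InnerProductSpace ℂ H] [CompleteSpace H]
    [TopologicalSpace.SeparableSpace H], ∀ X ∈ regularPolyball n H, (F H X).IsPositive

/-- On the polyball, `F(X) = ∑_{q=1}^m ∑_{α ∈ Γ_q} A_α^* ⊗ X_α^* + A₀ ⊗ I +
∑_{q=1}^m ∑_{α ∈ Γ_q} A_α ⊗ X_α` with `m ∈ ℕ ∪ {∞}`, where both series converge in the operator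
norm (for finite `m` they are finite sums). -/
def HasHomogeneousExpansion [CompleteSpace K] (F : FreeFunction n K) (m : ℕ∞)
    (A₀ : K →L[ℂ] K) (A : MultiWord n → (K →L[ℂ] K)) : Prop :=
  ∀ (H : Type) [NormedAddCommGroup H] [InnerProductSpace ℂ H] [CompleteSpace H]
    [TopologicalSpace.SeparableSpace H], ∀ X ∈ regularPolyball n H,
      ∃ G' G : HilbertTensor K H →L[ℂ] HilbertTensor K H,
        Filter.Tendsto (fun N : ℕ => ∑ q ∈ (Finset.Icc 1 N).filter (fun q : ℕ => (q : ℕ∞) ≤ m),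
          coHomPart A X q)
          Filter.atTop (nhds G') ∧
        Filter.Tendsto (fun N : ℕ => ∑ q ∈ (Finset.Icc 1 N).filter (fun q : ℕ => (q : ℕ∞) ≤ m),
          homPart A X q)
          Filter.atTop (nhds G) ∧
        F H X = G' + tensorOp A₀ 1 + G

end Functions

end NCPolyball

end

/-!
The theorem rests on two facts: a Poisson kernel that carries the universal model `S` to any point
of the polyball, and Fejér's inequality for the coefficients of nonnegative trigonometric
polynomials.

**Comparison with the universal model.** Let `X` lie in the regular polyball and write
`Δ_X(I) = D^* D`. Multiplying `Δ_X = ∏ (id - Φ_i)` by the geometric sums `∑_{p < N} Φ_i^p` gives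
`∑_β X_β Δ_X(I) X_β^* = ∏ (id - Φ_i^N) (I)`, with `β` running over the multi-words whose components
are shorter than `N`. As `‖Φ_i(I)‖ < 1`, this tends to `I`
(`tendsto_sum_wordBox_conj_defect`), so that `ξ ↦ ((I ⊗ D X_β^*) ξ)_β` is an isometry of `K ⊗ H`
into `ℓ²(K ⊗ H)`. It intertwines `X_α^*` with the backward shift by `α` (`poissonComp_mul`), whence
`⟨(∑ A_α ⊗ X_α) ξ, ξ⟩ = ∑_α ∑_β ⟨(A_α ⊗ I) u_β, u_{αβ}⟩` for the components `u_β` of the image of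
`ξ`. For `u_β` in `K` instead of `K ⊗ H` the right-hand side is the quadratic form of
`∑ A_α ⊗ S_α` at `∑ u_β ⊗ e_β` (`norm_shiftForm_le`); expanding the `u_β` along an orthonormal
family of `H` reduces to this case (`norm_shiftForm_ampliation_le`). This is
`numericalRadius_homPart_le`.

**Bounds for the universal model.** For `|z| < 1` the tuple `zS` lies in the polyball
(`smul_universalModel_mem`) and the part of `f(zS)` of degree `q` is `z^q` times that of `f(S)`.
For a unit vector `ξ`, the inequality `⟨f(zS) ξ, ξ⟩ ≥ 0` says that `a + 2 Re ∑_q c_q z^q ≥ 0` on the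
disc, where `a = ⟨(A₀ ⊗ I) ξ, ξ⟩ ≤ ‖A₀‖` and `c_q` is the value at `ξ` of the quadratic form of
`∑_{α ∈ Γ_q} A_α ⊗ S_α` (`exists_series_nonneg`). The coefficients of such a polynomial of degree
`M` satisfy `|c_q| ≤ a cos (π / (⌊M / q⌋ + 2))` (`norm_coeff_le_of_poly_nonneg`), and those of such
a series `|c_q| ≤ a` (`norm_coeff_le_of_series_nonneg`).
-/

noncomputable section

namespace NCPolyball

open scoped TensorProduct

/-! ### Operators on Hilbert tensor products -/

section TensorOp

variable {K H : Type*} [NormedAddCommGroup K] [InnerProductSpace ℂ K]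
  [NormedAddCommGroup H] [InnerProductSpace ℂ H]

/-- The elementary tensor `x ⊗ y` as a vector of the Hilbert tensor product. -/
def hmul (x : K) (y : H) : HilbertTensor K H := ((x ⊗ₜ[ℂ] y : K ⊗[ℂ] H) : HilbertTensor K H)

theorem inner_hmul (x x' : K) (y y' : H) :
    inner ℂ (hmul x y) (hmul x' y') = inner ℂ x x' * inner ℂ y y' := by
  simp [hmul, UniformSpace.Completion.inner_coe]

theorem tensorOp_coe (A : K →L[ℂ] K) (T : H →L[ℂ] H) (x : K ⊗[ℂ] H) :
    tensorOp A T (x : HilbertTensor K H) = (TensorProduct.mapL A T x : K ⊗[ℂ] H) :=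
  UniformSpace.Completion.map_coe (TensorProduct.mapL A T).uniformContinuous x

theorem tensorOp_hmul (A : K →L[ℂ] K) (T : H →L[ℂ] H) (x : K) (y : H) :
    tensorOp A T (hmul x y) = hmul (A x) (T y) := by
  rw [hmul, tensorOp_coe]; rfl

/-- A property that is closed, additive and true on elementary tensors holds on the whole Hilbert
tensor product. -/
theorem hilbertTensor_induction {P : HilbertTensor K H → Prop} (hc : IsClosed {x | P x})
    (h0 : P 0) (ht : ∀ x y, P (hmul x y)) (ha : ∀ x y, P x → P y → P (x + y))
    (x : HilbertTensor K H) : P x := by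
  refine UniformSpace.Completion.induction_on x hc fun a => ?_
  induction a using TensorProduct.induction_on with
  | zero => rw [UniformSpace.Completion.coe_zero]; exact h0
  | tmul x y => exact ht x y
  | add x y hx hy => rw [UniformSpace.Completion.coe_add]; exact ha _ _ hx hy

theorem hilbertTensor_clm_ext {E : Type*} [NormedAddCommGroup E] [NormedSpace ℂ E]
    {S T : HilbertTensor K H →L[ℂ] E} (h : ∀ x y, S (hmul x y) = T (hmul x y)) : S = T := by
  ext x
  refine hilbertTensor_induction (P := fun x => S x = T x)
    (isClosed_eq S.continuous T.continuous) (by simp) h (fun x y hx hy => by simp [hx, hy]) x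

theorem hmul_add (x : K) (y y' : H) : hmul x (y + y') = hmul x y + hmul x y' := by
  rw [hmul, TensorProduct.tmul_add, UniformSpace.Completion.coe_add]; rfl

theorem hmul_smul (c : ℂ) (x : K) (y : H) : hmul x (c • y) = c • hmul x y := by
  rw [hmul, TensorProduct.tmul_smul, UniformSpace.Completion.coe_smul]; rfl

theorem tensorOp_mul (A B : K →L[ℂ] K) (S T : H →L[ℂ] H) :
    tensorOp (A * B) (S * T) = tensorOp A S * tensorOp B T :=
  hilbertTensor_clm_ext fun x y => by simp [tensorOp_hmul]

theorem tensorOp_one : tensorOp (1 : K →L[ℂ] K) (1 : H →L[ℂ] H) = 1 :=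
  hilbertTensor_clm_ext fun x y => by simp [tensorOp_hmul]

theorem tensorOp_add_right (A : K →L[ℂ] K) (S T : H →L[ℂ] H) :
    tensorOp A (S + T) = tensorOp A S + tensorOp A T :=
  hilbertTensor_clm_ext fun x y => by simp [tensorOp_hmul, hmul_add]

theorem tensorOp_smul_right (c : ℂ) (A : K →L[ℂ] K) (T : H →L[ℂ] H) :
    tensorOp A (c • T) = c • tensorOp A T :=
  hilbertTensor_clm_ext fun x y => by simp [tensorOp_hmul, hmul_smul]

theorem norm_tensorOp_le (A : K →L[ℂ] K) (T : H →L[ℂ] H) : ‖tensorOp A T‖ ≤ ‖A‖ * ‖T‖ := by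
  refine ContinuousLinearMap.opNorm_le_bound _ (by positivity) fun x => ?_
  refine UniformSpace.Completion.induction_on x
    (isClosed_le (by fun_prop) (by fun_prop)) fun a => ?_
  rw [tensorOp_coe, UniformSpace.Completion.norm_coe, UniformSpace.Completion.norm_coe]
  exact (ContinuousLinearMap.le_opNorm _ _).trans
    (mul_le_mul_of_nonneg_right (TensorProduct.norm_mapL_le A T) (norm_nonneg _))

/-- Ampliation `T ↦ I ⊗ T` as a linear map. -/
def ampLin (K H : Type*) [NormedAddCommGroup K] [InnerProductSpace ℂ K]
    [NormedAddCommGroup H] [InnerProductSpace ℂ H] :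
    (H →L[ℂ] H) →ₗ[ℂ] (HilbertTensor K H →L[ℂ] HilbertTensor K H) where
  toFun T := tensorOp 1 T
  map_add' := tensorOp_add_right 1
  map_smul' c T := tensorOp_smul_right c 1 T

theorem ampLin_apply (T : H →L[ℂ] H) : ampLin K H T = tensorOp 1 T := rfl

theorem continuous_ampLin : Continuous (ampLin K H) :=
  AddMonoidHomClass.continuous_of_bound (ampLin K H) ‖(1 : K →L[ℂ] K)‖ fun T =>
    norm_tensorOp_le 1 T

theorem tensorOp_adjoint [CompleteSpace K] [CompleteSpace H] (A : K →L[ℂ] K) (T : H →L[ℂ] H) :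
    (tensorOp A T).adjoint = tensorOp A.adjoint T.adjoint := by
  symm
  rw [ContinuousLinearMap.eq_adjoint_iff]
  intro x y
  refine hilbertTensor_induction (P := fun x =>
    inner ℂ (tensorOp A.adjoint T.adjoint x) y = inner ℂ x (tensorOp A T y))
    (isClosed_eq (by fun_prop) (by fun_prop)) (by simp) (fun a b => ?_)
    (fun x y hx hy => by simp [inner_add_left, hx, hy]) x
  refine hilbertTensor_induction (P := fun y =>
    inner ℂ (tensorOp A.adjoint T.adjoint (hmul a b)) y = inner ℂ (hmul a b) (tensorOp A T y))
    (isClosed_eq (by fun_prop) (by fun_prop)) (by simp) (fun c d => ?_)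
    (fun x y hx hy => by simp [inner_add_right, hx, hy]) y
  simp only [tensorOp_hmul, inner_hmul, ContinuousLinearMap.adjoint_inner_left]

end TensorOp

/-! ### The numerical radius -/

section NumericalRadius

variable {H : Type*} [NormedAddCommGroup H] [InnerProductSpace ℂ H]

theorem numericalRadius_nonneg (T : H →L[ℂ] H) : 0 ≤ numericalRadius T :=
  Real.sSup_nonneg (by rintro x ⟨h, -, rfl⟩; exact norm_nonneg _)

theorem norm_inner_le_numericalRadius (T : H →L[ℂ] H) (h : H) :
    ‖inner ℂ (T h) h‖ ≤ numericalRadius T * ‖h‖ ^ 2 := by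
  have key : ∀ h : H, ‖h‖ = 1 → ‖inner ℂ (T h) h‖ ≤ numericalRadius T := fun h hh =>
    le_csSup ⟨‖T‖, by
      rintro x ⟨g, hg, rfl⟩
      calc ‖inner ℂ (T g) g‖ ≤ ‖T g‖ * ‖g‖ := norm_inner_le_norm _ _
        _ ≤ ‖T‖ := by simpa [hg] using T.le_opNorm g⟩ ⟨h, hh, rfl⟩
  rcases eq_or_ne h 0 with rfl | hne
  · simp
  have hpos : 0 < ‖h‖ := norm_pos_iff.mpr hne
  have h1 := key (((‖h‖⁻¹ : ℝ) : ℂ) • h) (by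
    rw [norm_smul]; simp [hpos.ne'])
  simp only [map_smul, inner_smul_left, inner_smul_right, norm_mul, Complex.norm_real,
    norm_inv, norm_norm, RCLike.norm_conj] at h1
  calc ‖inner ℂ (T h) h‖ = ‖h‖⁻¹ * (‖h‖⁻¹ * ‖inner ℂ (T h) h‖) * ‖h‖ ^ 2 := by field_simp
    _ ≤ _ := by gcongr

theorem numericalRadius_le {T : H →L[ℂ] H} {r : ℝ} (hr : 0 ≤ r)
    (h : ∀ x : H, ‖x‖ = 1 → ‖inner ℂ (T x) x‖ ≤ r) : numericalRadius T ≤ r :=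
  Real.sSup_le (by rintro x ⟨g, hg, rfl⟩; exact h g hg) hr

end NumericalRadius

/-! ### Coefficients of nonnegative trigonometric polynomials -/

section Fejer

open Complex

/-- The average of `e^{ijθ}` over the `N`-th roots of unity, rotated by half a step, vanishes
unless `N ∣ j`. -/
theorem sum_halfRotatedRoots_zpow {N : ℕ} (hN : N ≠ 0) {j : ℤ} (hj : ¬ (N : ℤ) ∣ j) :
    ∑ t ∈ Finset.range N, cexp (((2 * t + 1) * (Real.pi / N) : ℝ) * I) ^ j = 0 := by
  have hprim := Complex.isPrimitiveRoot_exp N hN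
  set ζ := cexp (2 * Real.pi * I / N) with hζ
  have hterm : ∀ t ∈ Finset.range N, cexp (((2 * t + 1) * (Real.pi / N) : ℝ) * I) ^ j =
      cexp ((Real.pi / N : ℝ) * I) ^ j * (ζ ^ j) ^ t := by
    intro t _
    rw [← zpow_natCast, ← zpow_mul, mul_comm j, zpow_mul, ← mul_zpow, zpow_natCast, hζ,
      ← Complex.exp_nat_mul, ← Complex.exp_add]
    congr 2
    push_cast
    ring
  rw [Finset.sum_congr rfl hterm, ← Finset.mul_sum]
  have hne : ζ ^ j ≠ 1 := fun h => hj ((hprim.zpow_eq_one_iff_dvd j).mp h)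
  have hpow : (ζ ^ j) ^ N = 1 := by
    rw [← zpow_natCast, ← zpow_mul, mul_comm, zpow_mul, zpow_natCast, hprim.pow_eq_one, one_zpow]
  rw [geom_sum_eq hne, hpow]
  simp

theorem norm_le_of_forall_re_mul_le {c : ℂ} {b : ℝ} (h : ∀ w : ℂ, ‖w‖ = 1 → (w * c).re ≤ b) :
    ‖c‖ ≤ b := by
  rcases eq_or_ne c 0 with rfl | hc
  · simpa using h 1 (by simp)
  have hn : (‖c‖ : ℂ) ≠ 0 := by simpa using hc
  have := h (starRingEnd ℂ c / ‖c‖) (by simp [hc])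
  rwa [div_mul_eq_mul_div, mul_comm, Complex.mul_conj, Complex.normSq_eq_norm_sq,
    show ((((‖c‖ ^ 2 : ℝ)) : ℂ) / ‖c‖) = (‖c‖ : ℂ) by push_cast; field_simp,
    Complex.ofReal_re] at this

/-- At the odd multiples of `π / L` the cosine is at most `cos (π / L)`. -/
theorem cos_odd_mul_pi_div_le {L : ℕ} (hL : L ≠ 0) (t : ℕ) :
    Real.cos ((2 * t + 1) * (Real.pi / L)) ≤ Real.cos (Real.pi / L) := by
  have hL' : (0 : ℝ) < L := by positivity
  have hper : ∀ s : ℕ, Real.sin ((((t / L : ℕ) * L + s : ℝ)) * (Real.pi / L)) =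
      (-1) ^ (t / L) * Real.sin (s * (Real.pi / L)) := by
    intro s
    rw [show ((((t / L : ℕ) * L + s : ℝ)) * (Real.pi / L)) =
      s * (Real.pi / L) + (t / L : ℕ) * Real.pi by field_simp; ring, Real.sin_add_nat_mul_pi]
  have hnn : ∀ s : ℕ, s ≤ L → 0 ≤ Real.sin (s * (Real.pi / L)) := by
    intro s hs
    apply Real.sin_nonneg_of_nonneg_of_le_pi (by positivity)
    have : (s : ℝ) ≤ L := by exact_mod_cast hs
    calc s * (Real.pi / L) ≤ L * (Real.pi / L) := by gcongr
      _ = Real.pi := by field_simp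
  have ht : (t : ℝ) = (t / L : ℕ) * L + (t % L : ℕ) := by
    exact_mod_cast (Nat.div_add_mod' t L).symm
  have h1 := hper (t % L)
  have h2 := hper (t % L + 1)
  rw [← ht] at h1
  rw [show ((t / L : ℕ) * L + ((t % L + 1 : ℕ) : ℝ)) = (t : ℝ) + 1 by push_cast; linarith] at h2
  have hlt := Nat.mod_lt t (Nat.pos_of_ne_zero hL)
  -- `cos x - cos y = -2 sin ((x + y) / 2) sin ((x - y) / 2)`, and both sines have the same sign
  have key := Real.cos_sub_cos (Real.pi / L) ((2 * t + 1) * (Real.pi / L))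
  rw [show (Real.pi / L + (2 * t + 1) * (Real.pi / L)) / 2 = (t + 1) * (Real.pi / L) by ring,
    show (Real.pi / L - (2 * t + 1) * (Real.pi / L)) / 2 = -(t * (Real.pi / L)) by ring,
    Real.sin_neg, h1, h2] at key
  have hsq : ((-1 : ℝ) ^ (t / L)) * (-1) ^ (t / L) = 1 := by
    rw [← mul_pow]; norm_num
  have := mul_nonneg (hnn _ hlt.le) (hnn (t % L + 1) hlt)
  have e : -2 * ((-1) ^ (t / L) * Real.sin ((t % L + 1 : ℕ) * (Real.pi / L))) *
      -((-1) ^ (t / L) * Real.sin ((t % L : ℕ) * (Real.pi / L))) =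
      2 * (Real.sin ((t % L : ℕ) * (Real.pi / L)) *
        Real.sin ((t % L + 1 : ℕ) * (Real.pi / L))) * (((-1 : ℝ) ^ (t / L)) * (-1) ^ (t / L)) := by
    ring
  rw [e, hsq] at key
  linarith

/-- **Fejér's inequality** for the real part of a coefficient of a nonnegative trigonometric
polynomial `p`. With `L = ⌊M / q⌋ + 2`, the `q L` nodes `e^{iθ}` at the odd multiples of `π / (q L)`
satisfy `cos (q θ) ≤ cos (π / L)`, and the quadrature over them is exact for
`p(θ) (cos (π / L) - cos (q θ))`, whose degree is less than `q L`. -/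
theorem re_coeff_le_of_trigPoly_nonneg {M q : ℕ} (hq : 1 ≤ q) (hqM : q ≤ M) {a : ℝ} {c : ℕ → ℂ}
    (hc : ∀ z : ℂ, ‖z‖ = 1 → 0 ≤ a + 2 * (∑ j ∈ Finset.Icc 1 M, c j * z ^ j).re) :
    (c q).re ≤ a * Real.cos (Real.pi / (((M / q : ℕ) : ℝ) + 2)) := by
  set L : ℕ := M / q + 2 with hL
  have hcast : ((M / q : ℕ) : ℝ) + 2 = L := by simp [hL]
  have hL0 : L ≠ 0 := by simp [hL]
  rw [hcast]
  set C := Real.cos (Real.pi / L)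
  set N : ℕ := q * L with hN
  have hqpos : 0 < q := hq
  have hN0 : N ≠ 0 := by positivity
  have hNM : M + q < N := by
    have := Nat.lt_mul_div_succ M hqpos
    rw [hN, hL]
    linarith
  set z : ℕ → ℂ := fun t => cexp (((2 * t + 1) * (Real.pi / N) : ℝ) * I) with hz
  have hz1 : ∀ t, ‖z t‖ = 1 := fun t => Complex.norm_exp_ofReal_mul_I _
  have hz0 : ∀ t, z t ≠ 0 := fun t => Complex.exp_ne_zero _
  set P : ℂ → ℂ := fun w => ∑ j ∈ Finset.Icc 1 M, c j * w ^ j with hP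
  have hzq : ∀ t, (z t ^ q).re = Real.cos ((2 * t + 1) * (Real.pi / L)) := by
    intro t
    rw [hz, ← Complex.exp_nat_mul, ← Complex.exp_ofReal_mul_I_re]
    congr 2
    have : (q : ℂ) ≠ 0 := by exact_mod_cast hqpos.ne'
    have : (L : ℂ) ≠ 0 := by exact_mod_cast hL0
    rw [hN]
    push_cast
    field_simp
  have hnn : 0 ≤ ∑ t ∈ Finset.range N, (a + 2 * (P (z t)).re) * (C - (z t ^ q).re) :=
    Finset.sum_nonneg fun t _ => mul_nonneg (hc _ (hz1 t)) (by
      rw [hzq]; exact sub_nonneg.mpr (cos_odd_mul_pi_div_le hL0 t))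
  have hσ : ∀ j : ℤ, ¬ (N : ℤ) ∣ j → ∑ t ∈ Finset.range N, z t ^ j = 0 :=
    fun j hj => sum_halfRotatedRoots_zpow hN0 hj
  have hndvd : ∀ j : ℤ, j ≠ 0 → |j| < N → ¬ (N : ℤ) ∣ j := fun j h0 hlt hd =>
    h0 (Int.eq_zero_of_abs_lt_dvd hd hlt)
  have hprod : ∀ t, 2 * (P (z t)).re * (z t ^ q).re =
      (P (z t) * z t ^ (q : ℤ)).re + (P (z t) * z t ^ (-q : ℤ)).re := by
    intro t
    have hconj : z t ^ (-q : ℤ) = starRingEnd ℂ (z t ^ q) := by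
      rw [zpow_neg, zpow_natCast, Complex.inv_def, Complex.normSq_eq_norm_sq]
      simp [hz1]
    rw [hconj, zpow_natCast]
    simp only [Complex.mul_re, Complex.conj_re, Complex.conj_im]
    ring
  have hmom : ∀ i : ℤ, ∑ t ∈ Finset.range N, P (z t) * z t ^ i =
      ∑ j ∈ Finset.Icc 1 M, c j * ∑ t ∈ Finset.range N, z t ^ (j + i : ℤ) := by
    intro i
    simp only [hP, Finset.sum_mul, Finset.mul_sum]
    rw [Finset.sum_comm]
    refine Finset.sum_congr rfl fun j _ => Finset.sum_congr rfl fun t _ => ?_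
    rw [zpow_add₀ (hz0 t), zpow_natCast, mul_assoc]
  have hm0 : ∑ t ∈ Finset.range N, P (z t) = 0 := by
    have := hmom 0
    simp only [zpow_zero, mul_one, add_zero] at this
    rw [this]
    refine Finset.sum_eq_zero fun j hj => ?_
    rw [Finset.mem_Icc] at hj
    rw [hσ _ (hndvd _ (by omega) (abs_lt.mpr ⟨by omega, by omega⟩)), mul_zero]
  have hmq : ∑ t ∈ Finset.range N, P (z t) * z t ^ (q : ℤ) = 0 := by
    rw [hmom]
    refine Finset.sum_eq_zero fun j hj => ?_
    rw [Finset.mem_Icc] at hj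
    rw [hσ _ (hndvd _ (by omega) (abs_lt.mpr ⟨by omega, by omega⟩)), mul_zero]
  have hmnq : ∑ t ∈ Finset.range N, P (z t) * z t ^ (-q : ℤ) = c q * N := by
    rw [hmom, Finset.sum_eq_single q]
    · simp
    · intro j hj hjq
      rw [Finset.mem_Icc] at hj
      rw [hσ _ (hndvd _ (by omega) (abs_lt.mpr ⟨by omega, by omega⟩)), mul_zero]
    · intro h
      exact absurd (Finset.mem_Icc.mpr ⟨hq, hqM⟩) h
  have hzq0 : ∑ t ∈ Finset.range N, (z t ^ q).re = 0 := by
    have := hσ q (hndvd _ (by omega) (by rw [abs_of_nonneg (by omega)]; omega))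
    simp only [zpow_natCast] at this
    rw [← Complex.re_sum, this, Complex.zero_re]
  have hsum : ∑ t ∈ Finset.range N, (a + 2 * (P (z t)).re) * (C - (z t ^ q).re) =
      N * (a * C - (c q).re) := by
    have : ∀ t, (a + 2 * (P (z t)).re) * (C - (z t ^ q).re) =
        a * C + 2 * C * (P (z t)).re - a * (z t ^ q).re -
          ((P (z t) * z t ^ (q : ℤ)).re + (P (z t) * z t ^ (-q : ℤ)).re) := by
      intro t; rw [← hprod]; ring
    simp only [this, Finset.sum_sub_distrib, Finset.sum_add_distrib, ← Finset.mul_sum,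
      ← Complex.re_sum, hm0, hmq, hmnq]
    rw [Complex.re_sum, hzq0]
    simp
    ring
  rw [hsum] at hnn
  have hNpos : (0 : ℝ) < N := by positivity
  linarith [nonneg_of_mul_nonneg_right hnn hNpos]

/-- **Fejér's inequality** for nonnegative trigonometric polynomials: rotating the variable reduces
it to the real part of the coefficient. -/
theorem norm_coeff_le_of_trigPoly_nonneg {M q : ℕ} (hq : 1 ≤ q) (hqM : q ≤ M) {a : ℝ}
    {c : ℕ → ℂ} (hc : ∀ z : ℂ, ‖z‖ = 1 → 0 ≤ a + 2 * (∑ j ∈ Finset.Icc 1 M, c j * z ^ j).re) :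
    ‖c q‖ ≤ a * Real.cos (Real.pi / (((M / q : ℕ) : ℝ) + 2)) := by
  refine norm_le_of_forall_re_mul_le fun w hw => ?_
  obtain ⟨u, hu⟩ := IsAlgClosed.exists_pow_nat_eq w (n := q) hq
  have hu1 : ‖u‖ = 1 := by
    have : ‖u‖ ^ q = 1 := by rw [← norm_pow, hu, hw]
    exact (pow_eq_one_iff_of_nonneg (norm_nonneg _) (by omega)).mp this
  have := re_coeff_le_of_trigPoly_nonneg (c := fun j => u ^ j * c j) (a := a) hq hqM
    (fun z hz => by
      have := hc (u * z) (by rw [norm_mul, hu1, hz, one_mul])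
      simpa only [mul_pow, mul_left_comm, mul_assoc] using this)
  simpa only [hu] using this

/-- If a power series without constant term has real part at least `-a / 2` on the open unit disc,
then on a circle of radius `r < 1` its truncations satisfy almost the same bound, uniformly. -/
theorem exists_truncation_nonneg {a : ℝ} {c : ℕ → ℂ}
    (hc : ∀ z : ℂ, ‖z‖ < 1 → ∃ g : ℂ, Filter.Tendsto
      (fun N => ∑ j ∈ Finset.Icc 1 N, c j * z ^ j) Filter.atTop (nhds g) ∧ 0 ≤ a + 2 * g.re)
    {r : ℝ} (hr0 : 0 < r) (hr1 : r < 1) {ε : ℝ} (hε : 0 < ε) (q : ℕ) :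
    ∃ M, q ≤ M ∧ ∀ z : ℂ, ‖z‖ = 1 →
      0 ≤ a + ε + 2 * (∑ j ∈ Finset.Icc 1 M, (c j * r ^ j) * z ^ j).re := by
  -- convergence at a radius `s > r` dominates the series at radius `r` by a geometric series
  obtain ⟨s, hrs, hs1⟩ := exists_between hr1
  have hs0 : 0 < s := hr0.trans hrs
  obtain ⟨g, hg, -⟩ := hc s (by rw [Complex.norm_real, Real.norm_of_nonneg hs0.le]; exact hs1)
  have hbdd : ∃ B : ℝ, ∀ j, 1 ≤ j → ‖c j‖ * s ^ j ≤ B := by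
    obtain ⟨B, hB⟩ := (Metric.isBounded_range_of_tendsto _ hg).exists_norm_le
    refine ⟨B + B, fun j hj => ?_⟩
    obtain ⟨i, rfl⟩ : ∃ i, j = i + 1 := ⟨j - 1, by omega⟩
    have h1 := hB _ ⟨i + 1, rfl⟩
    have h2 := hB _ ⟨i, rfl⟩
    have : c (i + 1) * s ^ (i + 1) = (∑ j ∈ Finset.Icc 1 (i + 1), c j * s ^ j) -
        ∑ j ∈ Finset.Icc 1 i, c j * s ^ j := by
      rw [Finset.sum_Icc_succ_top (by omega)]; ring
    have h3 := norm_sub_le (∑ j ∈ Finset.Icc 1 (i + 1), c j * (s : ℂ) ^ j)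
      (∑ j ∈ Finset.Icc 1 i, c j * (s : ℂ) ^ j)
    rw [← this, norm_mul, norm_pow, Complex.norm_real, Real.norm_of_nonneg hs0.le] at h3
    exact h3.trans (add_le_add h1 h2)
  obtain ⟨B, hB⟩ := hbdd
  set F : ℕ → ℝ := fun j => ‖c (j + 1)‖ * r ^ (j + 1) with hF
  have hsum : Summable F := by
    have hgeo : Summable fun j : ℕ => B * (r / s) * (r / s) ^ j :=
      (summable_geometric_of_lt_one (by positivity) ((div_lt_one hs0).mpr hrs)).mul_left _
    refine hgeo.of_nonneg_of_le (fun j => by positivity) fun j => ?_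
    calc F j = (‖c (j + 1)‖ * s ^ (j + 1)) * (r / s) ^ (j + 1) := by
          simp only [hF]; rw [mul_assoc, ← mul_pow, mul_div_cancel₀ _ hs0.ne']
      _ ≤ B * (r / s) ^ (j + 1) := by gcongr; exact hB _ (by omega)
      _ = _ := by ring
  have htail := (hsum.tendsto_sum_tsum_nat).eventually (lt_mem_nhds
    (show (∑' j, F j) - ε / 2 < ∑' j, F j by linarith))
  obtain ⟨M, hM, hqM⟩ := (htail.and (Filter.eventually_ge_atTop q)).exists
  refine ⟨M, hqM, fun z hz => ?_⟩
  have hrz : ‖(r : ℂ) * z‖ = r := by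
    rw [norm_mul, hz, Complex.norm_real, Real.norm_of_nonneg hr0.le, mul_one]
  obtain ⟨g, hg, hpos⟩ := hc (r * z) (hrz.trans_lt hr1)
  have hre : g.re ≤ (∑ j ∈ Finset.Icc 1 M, c j * (r * z) ^ j).re + ε / 2 := by
    refine le_of_tendsto ((Complex.continuous_re.tendsto _).comp hg) ?_
    filter_upwards [Filter.eventually_ge_atTop M] with N hN
    have hconv : ∀ n, ∑ j ∈ Finset.Icc 1 n, c j * (r * z) ^ j =
        ∑ j ∈ Finset.range n, c (j + 1) * (r * z) ^ (j + 1) := by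
      intro n
      rw [Finset.range_eq_Ico, Finset.sum_Ico_add' (fun j => c j * (r * z) ^ j) 0 n 1]
      rfl
    have hsplit := Finset.sum_range_add_sum_Ico
      (fun j => c (j + 1) * ((r : ℂ) * z) ^ (j + 1)) hN
    simp only [Function.comp_apply]
    rw [hconv, hconv, ← hsplit, Complex.add_re]
    gcongr
    refine (Complex.re_le_norm _).trans ((norm_sum_le _ _).trans ?_)
    have e1 : ∀ j, ‖c (j + 1) * ((r : ℂ) * z) ^ (j + 1)‖ = F j := by
      intro j; rw [norm_mul, norm_pow, hrz]
    simp only [e1]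
    have e2 := Finset.sum_range_add_sum_Ico F hN
    have e3 := hsum.sum_le_tsum (Finset.range N) (fun j _ => by positivity)
    linarith
  have e : ∑ j ∈ Finset.Icc 1 M, (c j * (r : ℂ) ^ j) * z ^ j =
      ∑ j ∈ Finset.Icc 1 M, c j * (r * z) ^ j :=
    Finset.sum_congr rfl fun j _ => by rw [mul_pow, mul_assoc]
  rw [e]
  linarith

theorem le_of_forall_mul_pow_le {x b : ℝ} {q : ℕ}
    (h : ∀ r : ℝ, 0 < r → r < 1 → x * r ^ q ≤ b) : x ≤ b := by
  have ht : Filter.Tendsto (fun r : ℝ => x * r ^ q) (nhdsWithin 1 (Set.Iio 1)) (nhds x) := by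
    have : Continuous fun r : ℝ => x * r ^ q := by fun_prop
    simpa using (this.tendsto 1).mono_left nhdsWithin_le_nhds
  refine le_of_tendsto ht ?_
  filter_upwards [Ioo_mem_nhdsLT (show (0 : ℝ) < 1 by norm_num)] with r hr
  exact h r hr.1 hr.2

/-- **Carathéodory's inequality** for the coefficients of a power series whose real part is at
least `-a / 2` on the open unit disc. It follows from Fejér's inequality for truncations, whose
cosine factor is at most `1`. -/
theorem norm_coeff_le_of_series_nonneg {a : ℝ} {c : ℕ → ℂ}
    (hc : ∀ z : ℂ, ‖z‖ < 1 → ∃ g : ℂ, Filter.Tendsto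
      (fun N => ∑ j ∈ Finset.Icc 1 N, c j * z ^ j) Filter.atTop (nhds g) ∧ 0 ≤ a + 2 * g.re)
    {q : ℕ} (hq : 1 ≤ q) : ‖c q‖ ≤ a := by
  refine le_of_forall_mul_pow_le (q := q) fun r hr0 hr1 => le_of_forall_pos_le_add fun ε hε => ?_
  obtain ⟨M, hqM, hM⟩ := exists_truncation_nonneg hc hr0 hr1 hε q
  have := norm_coeff_le_of_trigPoly_nonneg hq hqM hM
  rw [norm_mul, norm_pow, Complex.norm_real, Real.norm_of_nonneg hr0.le] at this
  have hx : 0 ≤ ‖c q‖ * r ^ q := by positivity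
  set t := Real.cos (Real.pi / (((M / q : ℕ) : ℝ) + 2))
  -- positivity of the cosine yields `0 ≤ a + ε`, so that the factor can be dropped
  have ht : 0 < t := by
    have h1 : (1 : ℝ) ≤ (M / q : ℕ) := by exact_mod_cast (Nat.one_le_div_iff hq).mpr hqM
    refine Real.cos_pos_of_mem_Ioo ⟨?_, ?_⟩
    · have : 0 ≤ Real.pi / (((M / q : ℕ) : ℝ) + 2) := by positivity
      linarith [Real.pi_pos]
    · exact div_lt_div_of_pos_left Real.pi_pos two_pos (by linarith)
  have ht1 : t ≤ 1 := Real.cos_le_one _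
  nlinarith [show 0 ≤ a + ε by by_contra! h; nlinarith]

/-- **Fejér's inequality** for a polynomial whose real part is at least `-a / 2` on the open unit
disc. -/
theorem norm_coeff_le_of_poly_nonneg {M : ℕ} {a : ℝ} {c : ℕ → ℂ}
    (hc : ∀ z : ℂ, ‖z‖ < 1 → 0 ≤ a + 2 * (∑ j ∈ Finset.Icc 1 M, c j * z ^ j).re)
    {q : ℕ} (hq : 1 ≤ q) (hqM : q ≤ M) :
    ‖c q‖ ≤ a * Real.cos (Real.pi / (((M / q : ℕ) : ℝ) + 2)) := by
  refine le_of_forall_mul_pow_le (q := q) fun r hr0 hr1 => ?_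
  have := norm_coeff_le_of_trigPoly_nonneg (c := fun j => c j * (r : ℂ) ^ j) (a := a) hq hqM
    fun z hz => by
      have := hc (r * z) (by
        rw [norm_mul, hz, Complex.norm_real, Real.norm_of_nonneg hr0.le, mul_one]; exact hr1)
      simpa only [mul_pow, mul_assoc] using this
  rwa [norm_mul, norm_pow, Complex.norm_real, Real.norm_of_nonneg hr0.le] at this

end Fejer

/-! ### Homogeneous parts at scaled tuples -/

section Tuples

variable {k : ℕ} {n : Fin k → ℕ} {H : Type*} [NormedAddCommGroup H] [InnerProductSpace ℂ H]

theorem mem_Gam {q : ℕ} {α : MultiWord n} : α ∈ Gam n q ↔ ∑ i, (α i).length = q := by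
  simp [Gam]

theorem word_smul (z : ℂ) (X : OpTuple n H) (i : Fin k) (w : FreeMonoid (Fin (n i))) :
    OpTuple.word (z • X) i w = z ^ w.length • X.word i w := by
  induction w using FreeMonoid.inductionOn' with
  | one => simp [OpTuple.word]
  | of_mul j w ih =>
    simp only [OpTuple.word, map_mul, FreeMonoid.lift_eval_of] at ih ⊢
    rw [ih, Pi.smul_apply, Pi.smul_apply, smul_mul_smul_comm, FreeMonoid.length_mul,
      FreeMonoid.length_of, pow_add, pow_one]

theorem monomial_smul (z : ℂ) (X : OpTuple n H) (α : MultiWord n) :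
    OpTuple.monomial (z • X) α = z ^ (∑ i, (α i).length) • X.monomial α := by
  have : ∀ l : List (Fin k), (l.map fun i => OpTuple.word (z • X) i (α i)).prod =
      z ^ (l.map fun i => (α i).length).sum • (l.map fun i => X.word i (α i)).prod := by
    intro l
    induction l with
    | nil => simp
    | cons i l ih =>
      rw [List.map_cons, List.prod_cons, ih, word_smul, smul_mul_smul_comm, ← pow_add,
        List.map_cons, List.sum_cons, List.map_cons, List.prod_cons]
  rw [OpTuple.monomial, this, OpTuple.monomial, ← List.sum_ofFn, List.ofFn_eq_map]

variable {K : Type*} [NormedAddCommGroup K] [InnerProductSpace ℂ K]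

theorem homPart_smul (A : MultiWord n → (K →L[ℂ] K)) (z : ℂ) (X : OpTuple n H) (q : ℕ) :
    homPart A (z • X) q = z ^ q • homPart A X q := by
  rw [homPart, homPart, Finset.smul_sum]
  refine Finset.sum_congr rfl fun α hα => ?_
  rw [monomial_smul, mem_Gam.mp hα, tensorOp_smul_right]

theorem coHomPart_eq_adjoint [CompleteSpace K] [CompleteSpace H] (A : MultiWord n → (K →L[ℂ] K))
    (X : OpTuple n H) (q : ℕ) : coHomPart A X q = (homPart A X q).adjoint := by
  simp only [coHomPart, homPart, map_sum, tensorOp_adjoint]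

end Tuples

/-! ### The universal model and the polyball -/

section Fock

variable {k : ℕ} {n : Fin k → ℕ}

theorem inner_fockBasis_left (α : MultiWord n) (v : FockSpace n) :
    inner ℂ (fockBasis n α) v = v α := by
  classical
  rw [fockBasis, lp.inner_single_left]; simp

theorem inner_fockBasis (α β : MultiWord n) [Decidable (α = β)] :
    inner ℂ (fockBasis n α) (fockBasis n β) = if α = β then (1 : ℂ) else 0 := by
  classical
  rw [orthonormal_iff_ite.mp (orthonormal_fockBasis n)]
  congr

theorem fock_ext {v w : FockSpace n}
    (h : ∀ α, inner ℂ (fockBasis n α) v = inner ℂ (fockBasis n α) w) : v = w := by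
  ext α
  simpa [inner_fockBasis_left] using h α

theorem hasSum_fockBasis (v : FockSpace n) : HasSum (fun α => v α • fockBasis n α) v := by
  classical
  have := lp.hasSum_single (E := fun _ : MultiWord n => ℂ) (p := 2) (by norm_num) v
  convert! this using 2 with α
  rw [fockBasis, ← lp.single_smul]
  simp

/-- Bounded operators on the Fock space are determined by their values on the basis. -/
theorem fock_clm_ext {E : Type*} [NormedAddCommGroup E] [NormedSpace ℂ E]
    {S T : FockSpace n →L[ℂ] E} (h : ∀ α, S (fockBasis n α) = T (fockBasis n α)) : S = T := by
  ext v
  have h1 := S.hasSum (hasSum_fockBasis v)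
  have h2 := T.hasSum (hasSum_fockBasis v)
  simp only [map_smul, h] at h1 h2
  exact h1.unique h2

/-- The Fock space is one of the separable spaces on which free functions are evaluated. -/
instance separableSpace_fockSpace : TopologicalSpace.SeparableSpace (FockSpace n) := by
  rw [← TopologicalSpace.isSeparable_univ_iff]
  have hcount : (Set.range (fockBasis n)).Countable := Set.countable_range _
  refine (hcount.isSeparable.span (R := ℂ)).closure.mono fun v _ => ?_
  refine mem_closure_of_tendsto (hasSum_fockBasis v) (Filter.Eventually.of_forall fun s => ?_)
  exact Submodule.sum_mem _ fun α _ => Submodule.smul_mem _ _ (Submodule.subset_span ⟨α, rfl⟩)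

theorem creation_commute {s t : Fin k} (hst : s ≠ t) (a : Fin (n s)) (b : Fin (n t)) :
    Commute (creation n s a) (creation n t b) := by
  refine fock_clm_ext fun α => ?_
  simp only [mul_apply_eq_comp, creation_fockBasis]
  congr 1
  simp [consWord, hst, hst.symm, Function.update_comm hst]

theorem creation_adjoint_fockBasis_consWord (i : Fin k) (a b : Fin (n i)) (α : MultiWord n) :
    (creation n i a).adjoint (fockBasis n (consWord i b α)) =
      if a = b then fockBasis n α else 0 := by
  classical
  refine fock_ext fun β => ?_
  rw [ContinuousLinearMap.adjoint_inner_right, creation_fockBasis, inner_fockBasis]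
  split_ifs with h1 h2 h2
  · subst h2
    rw [consWord_injective i a h1, inner_fockBasis, if_pos rfl]
  · have := congrFun h1 i
    simp only [consWord, Function.update_self] at this
    exact absurd (List.cons.inj this).1 h2
  · subst h2
    rw [inner_fockBasis, if_neg (fun h => h1 (by rw [h]))]
  · simp

theorem creation_adjoint_fockBasis_of_eq_one (i : Fin k) (a : Fin (n i)) {α : MultiWord n}
    (h : α i = 1) : (creation n i a).adjoint (fockBasis n α) = 0 := by
  classical
  refine fock_ext fun β => ?_
  rw [ContinuousLinearMap.adjoint_inner_right, creation_fockBasis, inner_fockBasis, if_neg]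
  · simp
  · intro h1
    have := congrFun h1 i
    rw [h, consWord, Function.update_self] at this
    exact List.cons_ne_nil _ _ this

/-- `∑_j S_{i,j} S_{i,j}^*`, the projection onto the span of the `e_α` with `α_i ≠ 1`. -/
def rangeProj (n : Fin k → ℕ) (i : Fin k) : FockSpace n →L[ℂ] FockSpace n :=
  ∑ j, creation n i j * (creation n i j).adjoint

theorem rangeProj_fockBasis (i : Fin k) (α : MultiWord n) [Decidable (α i = 1)] :
    rangeProj n i (fockBasis n α) = if α i = 1 then 0 else fockBasis n α := by
  simp only [rangeProj, sum_apply, mul_apply_eq_comp]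
  split_ifs with h
  · simp [creation_adjoint_fockBasis_of_eq_one i _ h]
  · obtain ⟨b, w, hw⟩ : ∃ b w, α i = FreeMonoid.of b * w := by
      rcases hα : α i with _ | ⟨b, w⟩
      · exact absurd hα h
      · exact ⟨b, w, rfl⟩
    have hα : α = consWord i b (Function.update α i w) := by
      simp [consWord, ← hw]
    rw [hα]
    simp [creation_adjoint_fockBasis_consWord, creation_fockBasis, apply_ite]

theorem rangeProj_mul_self (i : Fin k) : rangeProj n i * rangeProj n i = rangeProj n i := by
  classical
  refine fock_clm_ext fun α => ?_
  by_cases h : α i = 1 <;> simp [rangeProj_fockBasis, h]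

theorem rangeProj_adjoint (i : Fin k) : (rangeProj n i).adjoint = rangeProj n i := by
  simp only [rangeProj, map_sum, ← ContinuousLinearMap.star_eq_adjoint, star_mul, star_star]

theorem norm_rangeProj_le (i : Fin k) : ‖rangeProj n i‖ ≤ 1 := by
  have h := CStarRing.norm_star_mul_self (x := rangeProj n i)
  rw [ContinuousLinearMap.star_eq_adjoint, rangeProj_adjoint, rangeProj_mul_self] at h
  by_contra! hc
  nlinarith

theorem rangeProj_commute_creation {s t : Fin k} (hst : s ≠ t) (b : Fin (n t)) :
    Commute (rangeProj n s) (creation n t b) := by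
  classical
  refine fock_clm_ext fun α => ?_
  by_cases h : α s = 1 <;>
    simp [creation_fockBasis, rangeProj_fockBasis, consWord, hst, h]

theorem phi_smul_universalModel (z : ℂ) (i : Fin k) (Y : FockSpace n →L[ℂ] FockSpace n) :
    OpTuple.phi (z • universalModel n) i Y =
      ((‖z‖ ^ 2 : ℝ) : ℂ) • ∑ j, creation n i j * (Y * (creation n i j).adjoint) := by
  simp only [OpTuple.phi, LinearMap.sum_apply, Finset.smul_sum]
  refine Finset.sum_congr rfl fun j _ => ?_
  simp only [universalModel, Pi.smul_apply, LinearMap.comp_apply, LinearMap.mulLeft_apply,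
    LinearMap.mulRight_apply, map_smulₛₗ, smul_mul_assoc, mul_smul_comm, smul_smul]
  rw [RingHom.id_apply, mul_comm, Complex.mul_conj, Complex.normSq_eq_norm_sq]

/-- The scaled universal model lies in the polyball: `Δ_{zS}(I) = ∏_i (I - |z|² P_i)` with the
commuting projections `P_i` onto the ranges of the row isometries `S_i`. -/
theorem smul_universalModel_mem {z : ℂ} (hz : ‖z‖ < 1) :
    z • universalModel n ∈ regularPolyball n (FockSpace n) := by
  set t : ℝ := ‖z‖ ^ 2 with ht
  have ht0 : 0 ≤ t := by positivity
  have ht1 : t < 1 := by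
    rw [ht]; exact pow_lt_one₀ (norm_nonneg _) hz two_ne_zero
  have hnorm : ∀ i, ‖((t : ℝ) : ℂ) • rangeProj n i‖ < 1 := fun i => by
    rw [norm_smul, Complex.norm_real, Real.norm_of_nonneg ht0]
    nlinarith [norm_rangeProj_le (n := n) i, norm_nonneg (rangeProj n i)]
  have hphi : ∀ i (Y : FockSpace n →L[ℂ] FockSpace n), (∀ j, Commute Y (creation n i j)) →
      OpTuple.phi (z • universalModel n) i Y = Y * ((t : ℂ) • rangeProj n i) := by
    intro i Y hY
    rw [phi_smul_universalModel, rangeProj, mul_smul_comm, Finset.mul_sum]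
    congr 1
    refine Finset.sum_congr rfl fun j _ => ?_
    rw [← mul_assoc, ← mul_assoc, (hY j).eq]
  -- `1 - t P = (1 - s P)²` for a projection `P`, so that `(id - Φ_i) Y = (1 - s P_i) Y (1 - s P_i)`
  obtain ⟨s, hs⟩ : ∃ s : ℝ, 2 * s - s * s = t :=
    ⟨1 - √(1 - t), by nlinarith [Real.mul_self_sqrt (show 0 ≤ 1 - t by linarith)]⟩
  have hsq : ∀ i, (1 - (s : ℂ) • rangeProj n i) * (1 - (s : ℂ) • rangeProj n i) =
      1 - (t : ℂ) • rangeProj n i := by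
    intro i
    rw [← hs, sub_mul, one_mul, mul_sub, mul_one, smul_mul_smul_comm, rangeProj_mul_self]
    push_cast
    module
  set D : Fin k → Module.End ℂ (FockSpace n →L[ℂ] FockSpace n) :=
    fun i => LinearMap.id - OpTuple.phi (z • universalModel n) i with hD
  have main : ∀ l : List (Fin k), l.Nodup →
      ((l.map D).prod 1).IsPositive ∧ IsUnit ((l.map D).prod 1) ∧
        ∀ i ∉ l, ∀ j, Commute ((l.map D).prod 1) (creation n i j) := by
    intro l
    induction l with
    | nil =>
      intro _
      simp [Commute.one_left]
    | cons i l ih =>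
      intro hl
      obtain ⟨hil, hl⟩ := List.nodup_cons.mp hl
      obtain ⟨hp, hu, hc⟩ := ih hl
      rw [List.map_cons, List.prod_cons, Module.End.mul_apply]
      set Y := (l.map D).prod 1
      have hYself : Y.adjoint = Y := hp.isSelfAdjoint.adjoint_eq
      have heq : D i Y = Y * (1 - (t : ℂ) • rangeProj n i) := by
        rw [hD, LinearMap.sub_apply, LinearMap.id_apply, hphi i Y (hc i hil), mul_sub, mul_one]
      have hYP : Commute Y (rangeProj n i) := by
        refine Commute.sum_right _ _ _ fun j _ => (hc i hil j).mul_right ?_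
        have := (hc i hil j).star_star
        rwa [ContinuousLinearMap.star_eq_adjoint, ContinuousLinearMap.star_eq_adjoint,
          hYself] at this
      rw [heq]
      refine ⟨?_, hu.mul (isUnit_one_sub_of_norm_lt_one (hnorm i)), ?_⟩
      · have hcomm : Commute Y (1 - (s : ℂ) • rangeProj n i) :=
          (Commute.one_right _).sub_right (hYP.smul_right _)
        have hself : (1 - (s : ℂ) • rangeProj n i).adjoint = 1 - (s : ℂ) • rangeProj n i := by
          rw [map_sub, map_smulₛₗ, rangeProj_adjoint, Complex.conj_ofReal,
            ← ContinuousLinearMap.star_eq_adjoint, star_one]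
        have := hp.conj_adjoint (1 - (s : ℂ) • rangeProj n i)
        rw [hself] at this
        rw [← hsq, ← mul_assoc, hcomm.eq]
        exact this
      · intro i' hi' j
        rw [List.mem_cons, not_or] at hi'
        exact (hc i' hi'.2 j).mul_left ((Commute.one_left _).sub_left
          ((rangeProj_commute_creation (Ne.symm hi'.1) j).smul_left _))
  have hfull := main (List.finRange k) (List.nodup_finRange k)
  refine ⟨fun s t hst a b => ?_, fun i => ?_, hfull.1, hfull.2.1⟩
  · exact ((creation_commute hst a b).smul_left z).smul_right z
  · have h1 := phi_smul_universalModel z i (1 : FockSpace n →L[ℂ] FockSpace n)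
    have h2 := hphi i 1 (fun j => Commute.one_left _)
    rw [one_mul] at h2
    have h3 := hnorm i
    rw [← h2] at h3
    simpa [OpTuple.phi] using h3

theorem word_universalModel_fockBasis (i : Fin k) (w : FreeMonoid (Fin (n i)))
    (β : MultiWord n) :
    (universalModel n).word i w (fockBasis n β) =
      fockBasis n (Function.update β i (w * β i)) := by
  induction w using FreeMonoid.inductionOn' with
  | one => simp [OpTuple.word]
  | of_mul j w ih =>
    have : (universalModel n).word i (FreeMonoid.of j * w) =
        creation n i j * (universalModel n).word i w := by
      simp [OpTuple.word, universalModel]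
    rw [this, mul_apply_eq_comp, ih, creation_fockBasis]
    simp [consWord, mul_assoc]

theorem monomial_universalModel_fockBasis (α β : MultiWord n) :
    (universalModel n).monomial α (fockBasis n β) = fockBasis n (α * β) := by
  have : ∀ l : List (Fin k), l.Nodup →
      (l.map fun i => (universalModel n).word i (α i)).prod (fockBasis n β) =
        fockBasis n fun i => if i ∈ l then α i * β i else β i := by
    intro l
    induction l with
    | nil => simp
    | cons i l ih =>
      intro hl
      obtain ⟨hil, hl⟩ := List.nodup_cons.mp hl
      rw [List.map_cons, List.prod_cons, mul_apply_eq_comp, ih hl,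
        word_universalModel_fockBasis]
      congr 1
      funext l'
      by_cases h : l' = i
      · subst h; simp [hil]
      · simp [h]
  rw [OpTuple.monomial, this _ (List.nodup_finRange k)]
  congr 1
  funext i
  simp

end Fock

/-! ### Bounds for the universal model -/

theorem re_inner_tensorOp_one_le {K H : Type*} [NormedAddCommGroup K]
    [InnerProductSpace ℂ K] [NormedAddCommGroup H] [InnerProductSpace ℂ H]
    (A₀ : K →L[ℂ] K) {ξ : HilbertTensor K H} (hξ : ‖ξ‖ = 1) :
    (inner ℂ ξ (tensorOp A₀ (1 : H →L[ℂ] H) ξ)).re ≤ ‖A₀‖ := by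
  calc _ ≤ ‖ξ‖ * ‖tensorOp A₀ (1 : H →L[ℂ] H) ξ‖ :=
        (Complex.re_le_norm _).trans (norm_inner_le_norm _ _)
    _ ≤ ‖tensorOp A₀ (1 : H →L[ℂ] H)‖ := by
        simpa [hξ] using (tensorOp A₀ (1 : H →L[ℂ] H)).le_opNorm ξ
    _ ≤ ‖A₀‖ * ‖(1 : H →L[ℂ] H)‖ := norm_tensorOp_le _ _
    _ ≤ ‖A₀‖ := mul_le_of_le_one_right (norm_nonneg _) ContinuousLinearMap.norm_id_le

section UniversalBounds

variable {k : ℕ} {n : Fin k → ℕ}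
  {K : Type*} [NormedAddCommGroup K] [InnerProductSpace ℂ K] [CompleteSpace K]

/-- Compressing the positive operators `f(zS)` to a vector `ξ` yields a power series on the disc
with nonnegative real part. -/
theorem exists_series_nonneg {m : ℕ∞} {A₀ : K →L[ℂ] K} {A : MultiWord n → (K →L[ℂ] K)}
    {f : FreeFunction n K} (hpos : IsPositiveOnPolyball f)
    (hexp : HasHomogeneousExpansion f m A₀ A) (ξ : HilbertTensor K (FockSpace n))
    {z : ℂ} (hz : ‖z‖ < 1) :
    ∃ g : ℂ, Filter.Tendsto (fun N => ∑ q ∈ (Finset.Icc 1 N).filter (fun q : ℕ => (q : ℕ∞) ≤ m),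
        inner ℂ ξ (homPart A (universalModel n) q ξ) * z ^ q) Filter.atTop (nhds g) ∧
      0 ≤ (inner ℂ ξ (tensorOp A₀ 1 ξ)).re + 2 * g.re := by
  have hmem := smul_universalModel_mem (n := n) hz
  obtain ⟨G', G, hG', hG, hF⟩ := hexp (FockSpace n) _ hmem
  have hp := hpos (FockSpace n) _ hmem
  -- the two halves of the expansion are adjoint to each other
  have hadj : G' = G.adjoint := by
    refine tendsto_nhds_unique hG' ?_
    have := ((ContinuousLinearMap.adjoint (𝕜 := ℂ) (E := HilbertTensor K (FockSpace n))
      (F := HilbertTensor K (FockSpace n))).continuous.tendsto G).comp hG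
    simpa only [Function.comp_def, map_sum, coHomPart_eq_adjoint] using this
  refine ⟨inner ℂ ξ (G ξ), ?_, ?_⟩
  · have hcont : Continuous fun T : HilbertTensor K (FockSpace n) →L[ℂ]
        HilbertTensor K (FockSpace n) => inner ℂ ξ (T ξ) := by fun_prop
    have := (hcont.tendsto G).comp hG
    refine this.congr fun N => ?_
    simp only [Function.comp_apply, sum_apply, inner_sum, homPart_smul,
      smul_apply, inner_smul_right]
    exact Finset.sum_congr rfl fun q _ => mul_comm _ _
  · have h1 := hp.re_inner_nonneg_right ξ
    rw [hF, hadj] at h1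
    simp only [add_apply, inner_add_right,
      ContinuousLinearMap.adjoint_inner_right] at h1
    rw [← inner_conj_symm (G ξ) ξ] at h1
    simp only [map_add, RCLike.re_to_complex, Complex.conj_re] at h1
    linarith

theorem numericalRadius_homPart_universalModel_le_cos {M : ℕ} {A₀ : K →L[ℂ] K}
    {A : MultiWord n → (K →L[ℂ] K)}
    {f : FreeFunction n K} (hpos : IsPositiveOnPolyball f)
    (hexp : HasHomogeneousExpansion f M A₀ A) {q : ℕ} (hq : 1 ≤ q) (hqM : q ≤ M) :
    numericalRadius (homPart A (universalModel n) q) ≤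
      ‖A₀‖ * Real.cos (Real.pi / (((M / q : ℕ) : ℝ) + 2)) := by
  have hcos : 0 ≤ Real.cos (Real.pi / (((M / q : ℕ) : ℝ) + 2)) := by
    apply Real.cos_nonneg_of_neg_pi_div_two_le_of_le
    · have : 0 ≤ Real.pi / (((M / q : ℕ) : ℝ) + 2) := by positivity
      linarith [Real.pi_pos]
    · gcongr
      linarith [Nat.cast_nonneg (α := ℝ) (M / q)]
  refine numericalRadius_le (by positivity) fun ξ hξ => ?_
  rw [norm_inner_symm]
  refine (norm_coeff_le_of_poly_nonneg (M := M)
    (c := fun j => inner ℂ ξ (homPart A (universalModel n) j ξ)) (fun z hz => ?_) hq hqM).trans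
    (mul_le_mul_of_nonneg_right (re_inner_tensorOp_one_le A₀ hξ) hcos)
  obtain ⟨g, hg, h0⟩ := exists_series_nonneg hpos hexp ξ hz
  -- the partial sums are constant from `M` on
  have : g = ∑ j ∈ Finset.Icc 1 M, inner ℂ ξ (homPart A (universalModel n) j ξ) * z ^ j := by
    refine tendsto_nhds_unique hg (tendsto_const_nhds.congr' ?_)
    filter_upwards [Filter.eventually_ge_atTop M] with N hN
    refine Finset.sum_congr ?_ fun _ _ => rfl
    ext j
    simp only [Finset.mem_filter, Finset.mem_Icc, Nat.cast_le]
    omega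
  rwa [this] at h0

theorem numericalRadius_homPart_universalModel_le {A₀ : K →L[ℂ] K}
    {A : MultiWord n → (K →L[ℂ] K)}
    {f : FreeFunction n K} (hpos : IsPositiveOnPolyball f)
    (hexp : HasHomogeneousExpansion f ⊤ A₀ A) {q : ℕ} (hq : 1 ≤ q) :
    numericalRadius (homPart A (universalModel n) q) ≤ ‖A₀‖ := by
  refine numericalRadius_le (norm_nonneg _) fun ξ hξ => ?_
  rw [norm_inner_symm]
  refine (norm_coeff_le_of_series_nonneg
    (c := fun j => inner ℂ ξ (homPart A (universalModel n) j ξ)) (fun z hz => ?_) hq).trans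
    (re_inner_tensorOp_one_le A₀ hξ)
  simpa using exists_series_nonneg hpos hexp ξ hz

end UniversalBounds

/-! ### Ordered products -/

section Lists

theorem prod_map_mul_prod_map_of_commute {ι M : Type*} [Monoid M] (f g : ι → M) {l : List ι}
    (hl : l.Nodup) (h : ∀ i j, i ≠ j → Commute (f i) (g j)) :
    (l.map f).prod * (l.map g).prod = (l.map fun i => f i * g i).prod := by
  induction l with
  | nil => simp
  | cons i l ih =>
    obtain ⟨hil, hl⟩ := List.nodup_cons.mp hl
    have hc : Commute (l.map f).prod (g i) := by
      refine Commute.list_prod_left _ _ fun x hx => ?_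
      obtain ⟨j, hj, rfl⟩ := List.mem_map.mp hx
      exact h j i (fun e => hil (e ▸ hj))
    simp only [List.map_cons, List.prod_cons]
    rw [← ih hl, mul_assoc, ← mul_assoc _ (g i), hc.eq]
    simp only [mul_assoc]

/-- Expansion of an ordered product of finite sums over the box of index tuples. -/
theorem sum_piFinset_prod_finRange {R : Type*} [Semiring R] {k : ℕ} {κ : Fin k → Type*}
    (s : (i : Fin k) → Finset (κ i)) (F : (i : Fin k) → κ i → R) :
    ∑ p ∈ Fintype.piFinset s, ((List.finRange k).map fun i => F i (p i)).prod =
      ((List.finRange k).map fun i => ∑ w ∈ s i, F i w).prod := by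
  induction k with
  | zero => simp
  | succ k ih =>
    have hfil : Fintype.piFinset s =
        (s 0 ×ˢ Fintype.piFinset (Fin.tail s)).map (Fin.consEquiv κ).toEmbedding := by
      simpa using Finset.filter_piFinset_eq_map_consEquiv s (fun _ => True)
    rw [hfil, Finset.sum_map, Finset.sum_product]
    simp only [List.finRange_succ, List.map_cons, List.prod_cons, List.map_map, Function.comp_def,
      Equiv.coe_toEmbedding, Fin.consEquiv_apply, Fin.cons_zero, Fin.cons_succ]
    have := ih (fun i => s i.succ) (fun i => F i.succ)
    rw [← this, Finset.sum_mul]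
    simp only [Finset.mul_sum]
    rfl

end Lists

/-! ### Words of bounded length -/

section ShortWords

open scoped Classical in
/-- The words of length less than `N`. -/
def shortWords (X : Type*) [Fintype X] : ℕ → Finset (FreeMonoid X)
  | 0 => ∅
  | N + 1 => insert 1 ((Finset.univ ×ˢ shortWords X N).image fun p => FreeMonoid.of p.1 * p.2)

theorem mem_shortWords {X : Type*} [Fintype X] {N : ℕ} {w : FreeMonoid X} :
    w ∈ shortWords X N ↔ w.length < N := by
  classical
  induction N generalizing w with
  | zero => simp [shortWords]
  | succ N ih =>
    simp only [shortWords, Finset.mem_insert, Finset.mem_image, Finset.mem_product,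
      Finset.mem_univ, true_and, Prod.exists]
    constructor
    · rintro (rfl | ⟨a, w, hw, rfl⟩)
      · simp
      · rw [ih] at hw
        rw [FreeMonoid.length_mul, FreeMonoid.length_of]; omega
    · intro h
      rcases w with _ | ⟨a, w⟩
      · exact Or.inl rfl
      · refine Or.inr ⟨a, w, ih.mpr ?_, rfl⟩
        exact Nat.lt_of_succ_lt_succ h

theorem sum_shortWords_succ {X M : Type*} [Fintype X] [AddCommMonoid M] (N : ℕ)
    (F : FreeMonoid X → M) :
    ∑ w ∈ shortWords X (N + 1), F w =
      F 1 + ∑ j, ∑ w ∈ shortWords X N, F (FreeMonoid.of j * w) := by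
  classical
  rw [shortWords, Finset.sum_insert, Finset.sum_image, Finset.sum_product]
  · rintro ⟨a, w⟩ - ⟨b, w'⟩ - h
    obtain ⟨h1, h2⟩ := List.cons.inj h
    exact Prod.ext h1 h2
  · simp only [Finset.mem_image, not_exists, not_and]
    rintro ⟨a, w⟩ - h
    exact List.cons_ne_nil _ _ h

end ShortWords

/-! ### The Poisson kernel of a point of the polyball -/

section Poisson

variable {k : ℕ} {n : Fin k → ℕ} {H : Type*} [NormedAddCommGroup H] [InnerProductSpace ℂ H]

theorem word_commute {X : OpTuple n H}
    (hX : ∀ s t : Fin k, s ≠ t → ∀ a b, Commute (X s a) (X t b)) {s t : Fin k} (hst : s ≠ t)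
    (v : FreeMonoid (Fin (n s))) (w : FreeMonoid (Fin (n t))) :
    Commute (X.word s v) (X.word t w) := by
  have h1 : ∀ a, Commute (X s a) (X.word t w) := by
    intro a
    induction w using FreeMonoid.inductionOn' with
    | one => simp [OpTuple.word]
    | of_mul b w ih =>
      simp only [OpTuple.word, map_mul, FreeMonoid.lift_eval_of] at ih ⊢
      exact (hX s t hst a b).mul_right ih
  induction v using FreeMonoid.inductionOn' with
  | one => simp [OpTuple.word]
  | of_mul b v ih =>
    simp only [OpTuple.word, map_mul, FreeMonoid.lift_eval_of] at ih h1 ⊢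
    exact (h1 b).mul_left ih

theorem monomial_mul {X : OpTuple n H}
    (hX : ∀ s t : Fin k, s ≠ t → ∀ a b, Commute (X s a) (X t b)) (α β : MultiWord n) :
    X.monomial (α * β) = X.monomial α * X.monomial β := by
  rw [OpTuple.monomial, OpTuple.monomial, OpTuple.monomial,
    prod_map_mul_prod_map_of_commute (fun i => X.word i (α i)) (fun i => X.word i (β i))
      (List.nodup_finRange k) (fun i j hij => word_commute hX hij _ _)]
  congr 2
  funext i
  simp [OpTuple.word]

variable [CompleteSpace H]

/-- Conjugation `T ↦ (Y ↦ T Y T^*)` as a multiplicative map. -/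
def conjHom (H : Type*) [NormedAddCommGroup H] [InnerProductSpace ℂ H] [CompleteSpace H] :
    (H →L[ℂ] H) →* Module.End ℂ (H →L[ℂ] H) where
  toFun T := LinearMap.mulLeft ℂ T ∘ₗ LinearMap.mulRight ℂ T.adjoint
  map_one' := by
    ext1 Y
    simp [← ContinuousLinearMap.star_eq_adjoint]
  map_mul' S T := by
    ext1 Y
    simp [← ContinuousLinearMap.star_eq_adjoint, mul_assoc]

theorem conjHom_apply (T Y : H →L[ℂ] H) : conjHom H T Y = T * (Y * T.adjoint) := rfl

theorem phi_eq_sum_conjHom (X : OpTuple n H) (i : Fin k) : X.phi i = ∑ j, conjHom H (X i j) := rfl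

/-- The Cauchy–Schwarz bound `‖Φ(Y)‖ ≤ ‖Φ(I)‖ ‖Y‖` for the completely positive map `Φ`. -/
theorem norm_phi_le (X : OpTuple n H) (i : Fin k) (Y : H →L[ℂ] H) :
    ‖X.phi i Y‖ ≤ ‖∑ j, X i j * (X i j).adjoint‖ * ‖Y‖ := by
  set P := ∑ j, X i j * (X i j).adjoint with hP
  have hcol : ∀ h : H, ∑ j, ‖(X i j).adjoint h‖ ^ 2 ≤ ‖P‖ * ‖h‖ ^ 2 := by
    intro h
    have : ∑ j, ‖(X i j).adjoint h‖ ^ 2 = (inner ℂ (P h) h).re := by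
      simp only [hP, sum_apply, sum_inner, Complex.re_sum, mul_apply_eq_comp]
      refine Finset.sum_congr rfl fun j _ => ?_
      rw [← ContinuousLinearMap.adjoint_inner_right, inner_self_eq_norm_sq_to_K]
      norm_cast
    rw [this]
    calc _ ≤ ‖P h‖ * ‖h‖ := (Complex.re_le_norm _).trans (norm_inner_le_norm _ _)
      _ ≤ ‖P‖ * ‖h‖ * ‖h‖ := by gcongr; exact P.le_opNorm h
      _ = _ := by ring
  have hbil : ∀ h g : H, ‖inner ℂ g (X.phi i Y h)‖ ≤ ‖P‖ * ‖Y‖ * ‖h‖ * ‖g‖ := by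
    intro h g
    have e : inner ℂ g (X.phi i Y h) =
        ∑ j, inner ℂ ((X i j).adjoint g) (Y ((X i j).adjoint h)) := by
      simp only [phi_eq_sum_conjHom, LinearMap.sum_apply, sum_apply, inner_sum, conjHom_apply,
        mul_apply_eq_comp, ContinuousLinearMap.adjoint_inner_left]
    rw [e]
    calc _ ≤ ∑ j, ‖inner ℂ ((X i j).adjoint g) (Y ((X i j).adjoint h))‖ := norm_sum_le _ _
      _ ≤ ∑ j, ‖Y‖ * (‖(X i j).adjoint g‖ * ‖(X i j).adjoint h‖) := by
          refine Finset.sum_le_sum fun j _ => ?_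
          calc _ ≤ ‖(X i j).adjoint g‖ * ‖Y ((X i j).adjoint h)‖ := norm_inner_le_norm _ _
            _ ≤ ‖(X i j).adjoint g‖ * (‖Y‖ * ‖(X i j).adjoint h‖) := by
                gcongr; exact Y.le_opNorm _
            _ = _ := by ring
      _ = ‖Y‖ * ∑ j, ‖(X i j).adjoint g‖ * ‖(X i j).adjoint h‖ := by rw [Finset.mul_sum]
      _ ≤ ‖Y‖ * (√(∑ j, ‖(X i j).adjoint g‖ ^ 2) * √(∑ j, ‖(X i j).adjoint h‖ ^ 2)) := by
          gcongr; exact Real.sum_mul_le_sqrt_mul_sqrt _ _ _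
      _ ≤ ‖Y‖ * (√(‖P‖ * ‖g‖ ^ 2) * √(‖P‖ * ‖h‖ ^ 2)) := by
          gcongr
          · exact hcol g
          · exact hcol h
      _ = _ := by
          rw [Real.sqrt_mul (norm_nonneg _), Real.sqrt_mul (norm_nonneg _),
            Real.sqrt_sq (norm_nonneg _), Real.sqrt_sq (norm_nonneg _)]
          have := Real.mul_self_sqrt (norm_nonneg P)
          linear_combination (‖Y‖ * ‖g‖ * ‖h‖) * this
  refine ContinuousLinearMap.opNorm_le_bound _ (by positivity) fun h => ?_
  have h1 := hbil h (X.phi i Y h)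
  rw [inner_self_eq_norm_sq_to_K, norm_pow, RCLike.norm_ofReal, abs_norm, sq] at h1
  rcases (norm_nonneg (X.phi i Y h)).eq_or_lt with h0 | h0
  · rw [← h0]; positivity
  · exact le_of_mul_le_mul_right h1 h0

theorem norm_phi_pow_le (X : OpTuple n H) (i : Fin k) (N : ℕ) (Y : H →L[ℂ] H) :
    ‖(X.phi i ^ N) Y‖ ≤ ‖∑ j, X i j * (X i j).adjoint‖ ^ N * ‖Y‖ := by
  induction N with
  | zero => simp
  | succ N ih =>
    rw [pow_succ', Module.End.mul_apply]
    refine (norm_phi_le X i _).trans ?_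
    rw [pow_succ', mul_assoc]
    gcongr

/-- The multi-words all of whose components are shorter than `N`. -/
def wordBox (n : Fin k → ℕ) (N : ℕ) : Finset (MultiWord n) :=
  Fintype.piFinset fun i => shortWords (Fin (n i)) N

theorem mem_wordBox {N : ℕ} {β : MultiWord n} : β ∈ wordBox n N ↔ ∀ i, (β i).length < N := by
  simp [wordBox, mem_shortWords]

/-- The sum over the words shorter than `N` is the geometric sum `∑_{p < N} Φ_i^p`. -/
theorem sum_shortWords_mul_one_sub_phi (X : OpTuple n H) (i : Fin k) (N : ℕ) :
    (∑ w ∈ shortWords (Fin (n i)) N, conjHom H (X.word i w)) * (1 - X.phi i) =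
      1 - X.phi i ^ N := by
  induction N with
  | zero => simp [shortWords]
  | succ N ih =>
    have hstep : ∑ j, ∑ w ∈ shortWords (Fin (n i)) N, conjHom H (X.word i (FreeMonoid.of j * w)) =
        X.phi i * ∑ w ∈ shortWords (Fin (n i)) N, conjHom H (X.word i w) := by
      rw [phi_eq_sum_conjHom, Finset.sum_mul]
      refine Finset.sum_congr rfl fun j _ => ?_
      rw [Finset.mul_sum]
      refine Finset.sum_congr rfl fun w _ => ?_
      rw [← map_mul]
      simp [OpTuple.word]
    have h1 : conjHom H (X.word i 1) = 1 := by simp [OpTuple.word]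
    rw [sum_shortWords_succ, hstep, h1, add_mul, mul_assoc, ih, pow_succ']
    rw [one_mul, mul_sub, mul_one]
    abel

/-- Telescoping: `∑_β X_β Δ_X(I) X_β^* = ∏_i (id - Φ_i^N) (I)` when `β` runs over the words with
components shorter than `N`. -/
theorem sum_wordBox_conj_defect {X : OpTuple n H}
    (hX : ∀ s t : Fin k, s ≠ t → ∀ a b, Commute (X s a) (X t b)) (N : ℕ) :
    ∑ β ∈ wordBox n N, conjHom H (X.monomial β) (X.defect 1) =
      ((List.finRange k).map fun i => 1 - X.phi i ^ N).prod 1 := by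
  have h1 : ∀ β : MultiWord n, conjHom H (X.monomial β) =
      ((List.finRange k).map fun i => conjHom H (X.word i (β i))).prod := by
    intro β
    rw [OpTuple.monomial, map_list_prod, List.map_map]
    rfl
  have h2 : X.defect = ((List.finRange k).map fun i => 1 - X.phi i).prod := rfl
  rw [← LinearMap.sum_apply]
  simp only [h1]
  rw [wordBox, sum_piFinset_prod_finRange (fun i => shortWords (Fin (n i)) N)
    (fun i w => conjHom H (X.word i w)), ← Module.End.mul_apply, h2,
    prod_map_mul_prod_map_of_commute _ _ (List.nodup_finRange k)]
  · simp only [sum_shortWords_mul_one_sub_phi]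
  · intro i j hij
    refine (Commute.one_right _).sub_right (Commute.sum_left _ _ _ fun w _ => ?_)
    rw [phi_eq_sum_conjHom]
    refine Commute.sum_right _ _ _ fun a _ => ?_
    have := word_commute hX hij w (FreeMonoid.of a)
    rw [show X.word j (FreeMonoid.of a) = X j a by simp [OpTuple.word]] at this
    exact this.map (conjHom H)

/-- The Poisson kernel of `X` is an isometry: `∑_β X_β Δ_X(I) X_β^* = I`. -/
theorem tendsto_sum_wordBox_conj_defect {X : OpTuple n H} (hX : X ∈ regularPolyball n H) :
    Filter.Tendsto (fun N => ∑ β ∈ wordBox n N, conjHom H (X.monomial β) (X.defect 1))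
      Filter.atTop (nhds 1) := by
  simp only [sum_wordBox_conj_defect hX.1]
  set D : ℕ → Fin k → Module.End ℂ (H →L[ℂ] H) := fun N i => 1 - X.phi i ^ N with hD
  change Filter.Tendsto (fun N => ((List.finRange k).map (D N)).prod 1) Filter.atTop (nhds 1)
  induction List.finRange k with
  | nil => simp
  | cons i l ih =>
    simp only [List.map_cons, List.prod_cons, Module.End.mul_apply]
    have hDi : ∀ N Y, D N i Y = Y - (X.phi i ^ N) Y := fun N Y => rfl
    simp only [hDi]
    have hz : Filter.Tendsto (fun N => (X.phi i ^ N) ((l.map (D N)).prod 1))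
        Filter.atTop (nhds 0) := by
      refine squeeze_zero_norm (fun N => norm_phi_pow_le X i N _) ?_
      simpa using (tendsto_pow_atTop_nhds_zero_of_lt_one (norm_nonneg _) (hX.2.1 i)).mul ih.norm
    simpa using ih.sub hz

theorem tendsto_wordBox_atTop : Filter.Tendsto (wordBox n) Filter.atTop Filter.atTop := by
  refine Filter.tendsto_atTop_finset_of_monotone (fun N M hNM β hβ => ?_) fun β => ?_
  · rw [mem_wordBox] at hβ ⊢
    exact fun i => (hβ i).trans_le hNM
  · refine ⟨∑ i, (β i).length + 1, mem_wordBox.mpr fun i => Nat.lt_succ_of_le ?_⟩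
    exact Finset.single_le_sum (f := fun i => (β i).length) (fun _ _ => Nat.zero_le _)
      (Finset.mem_univ i)

/-- The `β`-th component of the Poisson kernel `ξ ↦ ∑_β e_β ⊗ (I ⊗ D X_β^*) ξ`, where
`Δ_X(I) = D^* D`. -/
def poissonComp (K : Type*) [NormedAddCommGroup K] [InnerProductSpace ℂ K] (X : OpTuple n H)
    (D : H →L[ℂ] H) (β : MultiWord n) : HilbertTensor K H →L[ℂ] HilbertTensor K H :=
  tensorOp 1 (D * (X.monomial β).adjoint)

variable {K : Type*} [NormedAddCommGroup K] [InnerProductSpace ℂ K]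

/-- The Poisson kernel intertwines `X_α^*` with the backward shift by `α`. -/
theorem poissonComp_mul {X : OpTuple n H}
    (hX : ∀ s t : Fin k, s ≠ t → ∀ a b, Commute (X s a) (X t b)) (D : H →L[ℂ] H)
    (α β : MultiWord n) :
    poissonComp K X D (α * β) = poissonComp K X D β * tensorOp 1 (X.monomial α).adjoint := by
  rw [poissonComp, poissonComp, ← tensorOp_mul, monomial_mul hX]
  simp only [← ContinuousLinearMap.star_eq_adjoint, mul_one, star_mul, mul_assoc]

variable [CompleteSpace K]

theorem tendsto_sum_inner_poissonComp {X : OpTuple n H} (hX : X ∈ regularPolyball n H)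
    {D : H →L[ℂ] H} (hD : X.defect 1 = D.adjoint * D) (η ζ : HilbertTensor K H) :
    Filter.Tendsto (fun N => ∑ β ∈ wordBox n N,
      inner ℂ (poissonComp K X D β η) (poissonComp K X D β ζ)) Filter.atTop
        (nhds (inner ℂ η ζ)) := by
  have hcont : Continuous fun T : H →L[ℂ] H => inner ℂ η (ampLin K H T ζ) := by
    have := continuous_ampLin (K := K) (H := H)
    fun_prop
  have := (hcont.tendsto 1).comp (tendsto_sum_wordBox_conj_defect hX)
  rw [ampLin_apply, tensorOp_one] at this
  refine this.congr fun N => ?_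
  simp only [Function.comp_apply, map_sum, sum_apply, inner_sum]
  refine Finset.sum_congr rfl fun β _ => ?_
  rw [poissonComp, ← ContinuousLinearMap.adjoint_inner_right, tensorOp_adjoint,
    conjHom_apply, hD, ampLin_apply, ← mul_apply_eq_comp (tensorOp _ _), ← tensorOp_mul]
  simp only [← ContinuousLinearMap.star_eq_adjoint, star_one, mul_one, star_mul, star_star,
    mul_assoc]

theorem summable_norm_sq_poissonComp {X : OpTuple n H} (hX : X ∈ regularPolyball n H)
    {D : H →L[ℂ] H} (hD : X.defect 1 = D.adjoint * D) (ξ : HilbertTensor K H) :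
    Summable (fun β => ‖poissonComp K X D β ξ‖ ^ 2) ∧
      ∀ s : Finset (MultiWord n), ∑ β ∈ s, ‖poissonComp K X D β ξ‖ ^ 2 ≤ ‖ξ‖ ^ 2 := by
  have ht : Filter.Tendsto (fun N => ∑ β ∈ wordBox n N, ‖poissonComp K X D β ξ‖ ^ 2)
      Filter.atTop (nhds (‖ξ‖ ^ 2)) := by
    have := (Complex.continuous_re.tendsto _).comp (tendsto_sum_inner_poissonComp hX hD ξ ξ)
    simpa only [Function.comp_def, inner_self_eq_norm_sq_to_K, Complex.re_sum,
      Complex.coe_algebraMap, ← Complex.ofReal_pow, Complex.ofReal_re] using this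
  have hmono : Monotone fun N => ∑ β ∈ wordBox n N, ‖poissonComp K X D β ξ‖ ^ 2 := by
    intro N M hNM
    refine Finset.sum_le_sum_of_subset_of_nonneg (fun β hβ => ?_) fun _ _ _ => by positivity
    rw [mem_wordBox] at hβ ⊢
    exact fun i => (hβ i).trans_le hNM
  have hle : ∀ s : Finset (MultiWord n), ∑ β ∈ s, ‖poissonComp K X D β ξ‖ ^ 2 ≤ ‖ξ‖ ^ 2 := by
    intro s
    obtain ⟨N, hN⟩ := (tendsto_wordBox_atTop.eventually (Filter.eventually_ge_atTop s)).exists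
    exact (Finset.sum_le_sum_of_subset_of_nonneg hN fun _ _ _ => by positivity).trans
      (hmono.ge_of_tendsto ht N)
  exact ⟨summable_of_sum_le (fun _ => by positivity) hle, hle⟩

theorem hasSum_inner_poissonComp {X : OpTuple n H} (hX : X ∈ regularPolyball n H)
    {D : H →L[ℂ] H} (hD : X.defect 1 = D.adjoint * D) (η ζ : HilbertTensor K H) :
    HasSum (fun β => inner ℂ (poissonComp K X D β η) (poissonComp K X D β ζ))
      (inner ℂ η ζ) := by
  have hs : Summable fun β => inner ℂ (poissonComp K X D β η) (poissonComp K X D β ζ) := by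
    refine Summable.of_norm_bounded ((summable_norm_sq_poissonComp hX hD η).1.add
      (summable_norm_sq_poissonComp hX hD ζ).1) fun β => (norm_inner_le_norm _ _).trans ?_
    nlinarith [sq_nonneg (‖poissonComp K X D β η‖ - ‖poissonComp K X D β ζ‖),
      sq_nonneg ‖poissonComp K X D β η‖, sq_nonneg ‖poissonComp K X D β ζ‖]
  have := tendsto_nhds_unique (hs.hasSum.comp tendsto_wordBox_atTop)
    (tendsto_sum_inner_poissonComp hX hD η ζ)
  rw [← this]
  exact hs.hasSum

end Poisson

/-! ### Comparison with the universal model -/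

section Ampliation

variable {k : ℕ} {n : Fin k → ℕ} {K : Type*} [NormedAddCommGroup K] [InnerProductSpace ℂ K]

open scoped Classical in
/-- The quadratic form of `∑_{α ∈ Γ_q} A_α ⊗ S_α` at the vector `∑_{β ∈ s} v_β ⊗ e_β`. -/
theorem norm_shiftForm_le (A : MultiWord n → (K →L[ℂ] K)) (q : ℕ) (s : Finset (MultiWord n))
    (v : MultiWord n → K) :
    ‖∑ α ∈ Gam n q, ∑ β ∈ s, if α * β ∈ s then inner ℂ (A α (v β)) (v (α * β)) else 0‖ ≤
      numericalRadius (homPart A (universalModel n) q) * ∑ β ∈ s, ‖v β‖ ^ 2 := by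
  set w : HilbertTensor K (FockSpace n) := ∑ β ∈ s, hmul (v β) (fockBasis n β) with hw
  have hnorm : ‖w‖ ^ 2 = ∑ β ∈ s, ‖v β‖ ^ 2 := by
    have : (inner ℂ w w) = ((∑ β ∈ s, ‖v β‖ ^ 2 : ℝ) : ℂ) := by
      rw [hw, sum_inner]
      simp only [inner_sum, inner_hmul, inner_fockBasis, mul_ite, mul_one, mul_zero,
        Finset.sum_ite_eq]
      push_cast
      refine Finset.sum_congr rfl fun β hβ => ?_
      rw [if_pos hβ, inner_self_eq_norm_sq_to_K]
      rfl
    rw [inner_self_eq_norm_sq_to_K] at this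
    refine Complex.ofReal_injective ?_
    rw [← this]
    push_cast
    rfl
  have hform : inner ℂ (homPart A (universalModel n) q w) w =
      ∑ α ∈ Gam n q, ∑ β ∈ s, if α * β ∈ s then inner ℂ (A α (v β)) (v (α * β)) else 0 := by
    rw [homPart, sum_apply, sum_inner]
    refine Finset.sum_congr rfl fun α _ => ?_
    rw [hw, map_sum, sum_inner]
    refine Finset.sum_congr rfl fun β _ => ?_
    rw [tensorOp_hmul, monomial_universalModel_fockBasis, inner_sum]
    simp only [inner_hmul, inner_fockBasis, mul_ite, mul_one, mul_zero, Finset.sum_ite_eq]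
  rw [← hform, ← hnorm]
  exact norm_inner_le_numericalRadius _ _

variable {H : Type*} [NormedAddCommGroup H] [InnerProductSpace ℂ H]

/-- Finitely many algebraic tensors have coordinates in `K` along a common finite orthonormal
family of `H`. -/
theorem exists_orthonormal_coords {ι : Type*} (s : Finset ι) (a : ι → K ⊗[ℂ] H) :
    ∃ (d : ℕ) (e : Fin d → H) (v : ι → Fin d → K), Orthonormal ℂ e ∧
      ∀ β ∈ s, a β = ∑ i, v β i ⊗ₜ[ℂ] e i := by
  obtain ⟨H', hfin, hH'⟩ := TensorProduct.exists_finite_submodule_right_of_setFinite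
    (a '' (s : Set ι)) (s.finite_toSet.image a)
  let b := stdOrthonormalBasis ℂ H'
  have hspan : ∀ y : K ⊗[ℂ] H', ∃ v : Fin (Module.finrank ℂ H') → K,
      H'.subtype.lTensor K y = ∑ i, v i ⊗ₜ[ℂ] (b i : H) := by
    intro y
    induction y using TensorProduct.induction_on with
    | zero => exact ⟨0, by simp⟩
    | tmul x h =>
      refine ⟨fun i => b.repr h i • x, ?_⟩
      have := congrArg (H'.subtype) (b.sum_repr h)
      rw [LinearMap.lTensor_tmul, ← this]
      simp [TensorProduct.tmul_sum, TensorProduct.smul_tmul]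
    | add y y' hy hy' =>
      obtain ⟨v, hv⟩ := hy
      obtain ⟨v', hv'⟩ := hy'
      exact ⟨v + v', by simp [hv, hv', TensorProduct.add_tmul, Finset.sum_add_distrib]⟩
  have hex : ∀ β, ∃ v : Fin (Module.finrank ℂ H') → K, β ∈ s →
      a β = ∑ i, v i ⊗ₜ[ℂ] (b i : H) := by
    intro β
    by_cases hβ : β ∈ s
    · obtain ⟨y, hy⟩ := hH' ⟨β, hβ, rfl⟩
      obtain ⟨v, hv⟩ := hspan y
      exact ⟨v, fun _ => hy ▸ hv⟩
    · exact ⟨0, fun h => absurd h hβ⟩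
  choose v hv using hex
  exact ⟨_, fun i => (b i : H), v, b.orthonormal.comp_linearIsometry H'.subtypeₗᵢ, hv⟩

theorem inner_sum_hmul_of_orthonormal {d : ℕ} {e : Fin d → H} (he : Orthonormal ℂ e)
    (x y : Fin d → K) :
    inner ℂ (∑ i, hmul (x i) (e i)) (∑ i, hmul (y i) (e i)) = ∑ i, inner ℂ (x i) (y i) := by
  rw [sum_inner]
  simp only [inner_sum, inner_hmul, orthonormal_iff_ite.mp he, mul_ite, mul_one, mul_zero,
    Finset.sum_ite_eq, Finset.mem_univ, if_true]

theorem norm_sq_sum_hmul_of_orthonormal {d : ℕ} {e : Fin d → H} (he : Orthonormal ℂ e)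
    (x : Fin d → K) : ‖∑ i, hmul (x i) (e i)‖ ^ 2 = ∑ i, ‖x i‖ ^ 2 := by
  have := congrArg Complex.re (inner_sum_hmul_of_orthonormal he x x)
  rw [← RCLike.re_to_complex, inner_self_eq_norm_sq] at this
  rw [this, Complex.re_sum]
  refine Finset.sum_congr rfl fun i _ => ?_
  rw [← RCLike.re_to_complex, inner_self_eq_norm_sq]

open scoped Classical in
/-- Along an orthonormal family of `H` the quadratic form of the ampliation splits into a sum. -/
theorem norm_shiftForm_ampliation_le_of_orthonormal (A : MultiWord n → (K →L[ℂ] K)) (q : ℕ)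
    (s : Finset (MultiWord n)) {d : ℕ} {e : Fin d → H} (he : Orthonormal ℂ e)
    (v : MultiWord n → Fin d → K) (u : MultiWord n → HilbertTensor K H)
    (hu : ∀ β ∈ s, u β = ∑ i, hmul (v β i) (e i)) :
    ‖∑ α ∈ Gam n q, ∑ β ∈ s,
        if α * β ∈ s then inner ℂ (tensorOp (A α) 1 (u β)) (u (α * β)) else 0‖ ≤
      numericalRadius (homPart A (universalModel n) q) * ∑ β ∈ s, ‖u β‖ ^ 2 := by
  have hform : (∑ α ∈ Gam n q, ∑ β ∈ s,
        if α * β ∈ s then inner ℂ (tensorOp (A α) 1 (u β)) (u (α * β)) else 0) =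
      ∑ i, ∑ α ∈ Gam n q, ∑ β ∈ s,
        if α * β ∈ s then inner ℂ (A α (v β i)) (v (α * β) i) else 0 := by
    conv_rhs => rw [Finset.sum_comm]
    refine Finset.sum_congr rfl fun α _ => ?_
    conv_rhs => rw [Finset.sum_comm]
    refine Finset.sum_congr rfl fun β hβ => ?_
    split_ifs with h
    · have hA : tensorOp (A α) 1 (u β) = ∑ i, hmul (A α (v β i)) (e i) := by
        rw [hu β hβ, map_sum]
        exact Finset.sum_congr rfl fun i _ => tensorOp_hmul _ _ _ _
      rw [hA, hu _ h]
      exact inner_sum_hmul_of_orthonormal he _ _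
    · rw [Finset.sum_const_zero]
  have hnorm : ∀ β ∈ s, ‖u β‖ ^ 2 = ∑ i, ‖v β i‖ ^ 2 := fun β hβ => by
    rw [hu β hβ, norm_sq_sum_hmul_of_orthonormal he]
  rw [hform, Finset.sum_congr rfl hnorm, Finset.sum_comm (s := s) (t := Finset.univ),
    Finset.mul_sum]
  refine (norm_sum_le _ _).trans (Finset.sum_le_sum fun i _ => ?_)
  exact norm_shiftForm_le A q s (fun β => v β i)

open scoped Classical in
theorem isClosed_norm_shiftForm_ampliation_le (A : MultiWord n → (K →L[ℂ] K)) (q : ℕ) (r : ℝ)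
    (s : Finset (MultiWord n)) :
    IsClosed {u : MultiWord n → HilbertTensor K H | ‖∑ α ∈ Gam n q, ∑ β ∈ s,
        if α * β ∈ s then inner ℂ (tensorOp (A α) 1 (u β)) (u (α * β)) else 0‖ ≤
      r * ∑ β ∈ s, ‖u β‖ ^ 2} := by
  refine isClosed_le (continuous_finsetSum _ fun α _ => continuous_finsetSum _ fun β _ => ?_).norm
    (continuous_const.mul (continuous_finsetSum _ fun β _ => (continuous_apply β).norm.pow 2))
  split_ifs
  · exact ((tensorOp (A α) 1).continuous.comp (continuous_apply β)).inner (continuous_apply _)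
  · exact continuous_const

open scoped Classical in
/-- The bound on the quadratic form of `∑_{α ∈ Γ_q} A_α ⊗ S_α` is stable under ampliation from `K`
to `K ⊗ H`. -/
theorem norm_shiftForm_ampliation_le (A : MultiWord n → (K →L[ℂ] K)) (q : ℕ)
    (s : Finset (MultiWord n)) (u : MultiWord n → HilbertTensor K H) :
    ‖∑ α ∈ Gam n q, ∑ β ∈ s,
        if α * β ∈ s then inner ℂ (tensorOp (A α) 1 (u β)) (u (α * β)) else 0‖ ≤
      numericalRadius (homPart A (universalModel n) q) * ∑ β ∈ s, ‖u β‖ ^ 2 := by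
  have hdense : DenseRange (Pi.map fun (_ : MultiWord n) (x : K ⊗[ℂ] H) =>
      (x : HilbertTensor K H)) :=
    DenseRange.piMap fun _ => UniformSpace.Completion.denseRange_coe
  have hsub := closure_minimal (s := Set.range (Pi.map fun (_ : MultiWord n) (x : K ⊗[ℂ] H) =>
      (x : HilbertTensor K H))) ?_ (isClosed_norm_shiftForm_ampliation_le (H := H) A q
        (numericalRadius (homPart A (universalModel n) q)) s)
  · exact hsub (hdense u)
  rintro _ ⟨a, rfl⟩
  obtain ⟨d, e, v, he, hv⟩ := exists_orthonormal_coords s a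
  refine norm_shiftForm_ampliation_le_of_orthonormal A q s he v _ fun β hβ => ?_
  rw [Pi.map_apply, hv β hβ]
  exact map_sum (UniformSpace.Completion.toComplL (𝕜 := ℂ) (E := K ⊗[ℂ] H)) _ _

end Ampliation

/-- A von Neumann type inequality for numerical radii: the Poisson kernel of `X` turns the quadratic
form of `∑ A_α ⊗ X_α` into that of an ampliation of `∑ A_α ⊗ S_α`. -/
theorem numericalRadius_homPart_le {k : ℕ} {n : Fin k → ℕ}
    {K : Type*} [NormedAddCommGroup K] [InnerProductSpace ℂ K] [CompleteSpace K]
    {H : Type*} [NormedAddCommGroup H] [InnerProductSpace ℂ H] [CompleteSpace H]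
    (A : MultiWord n → (K →L[ℂ] K)) {X : OpTuple n H} (hX : X ∈ regularPolyball n H) (q : ℕ) :
    numericalRadius (homPart A X q) ≤ numericalRadius (homPart A (universalModel n) q) := by
  classical
  obtain ⟨D, hD⟩ : ∃ D : H →L[ℂ] H, X.defect 1 = D.adjoint * D := by
    have := (ContinuousLinearMap.nonneg_iff_isPositive _).mpr hX.2.2.1
    exact CStarAlgebra.nonneg_iff_eq_star_mul_self.mp this
  refine numericalRadius_le (numericalRadius_nonneg _) fun ξ hξ => ?_
  set u := fun β => poissonComp K X D β ξ with hu
  have hterm : ∀ α β, inner ℂ (tensorOp (A α) 1 (u β)) (u (α * β)) =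
      inner ℂ (poissonComp K X D β (tensorOp (A α) 1 ξ))
        (poissonComp K X D β (tensorOp 1 (X.monomial α).adjoint ξ)) := by
    intro α β
    simp only [hu]
    rw [poissonComp_mul hX.1, mul_apply_eq_comp]
    congr 1
    rw [poissonComp, ← mul_apply_eq_comp, ← mul_apply_eq_comp, ← tensorOp_mul, ← tensorOp_mul]
    simp
  have hsum : ∀ α, HasSum (fun β => inner ℂ (tensorOp (A α) 1 (u β)) (u (α * β)))
      (inner ℂ (tensorOp (A α) (X.monomial α) ξ) ξ) := by
    intro α
    simp only [hterm]
    convert! hasSum_inner_poissonComp hX hD (tensorOp (A α) 1 ξ)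
      (tensorOp 1 (X.monomial α).adjoint ξ) using 1
    have : tensorOp (1 : K →L[ℂ] K) (X.monomial α).adjoint =
        (tensorOp 1 (X.monomial α)).adjoint := by
      rw [tensorOp_adjoint, ← ContinuousLinearMap.star_eq_adjoint (1 : K →L[ℂ] K), star_one]
    rw [this, ContinuousLinearMap.adjoint_inner_right, ← mul_apply_eq_comp, ← tensorOp_mul,
      one_mul, mul_one]
  -- truncation of the index `β` to a finite set containing both `β` and `α β`
  have htrunc : ∀ α, Filter.Tendsto (fun s : Finset (MultiWord n) => ∑ β ∈ s,
      if α * β ∈ s then inner ℂ (tensorOp (A α) 1 (u β)) (u (α * β)) else 0) Filter.atTop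
        (nhds (inner ℂ (tensorOp (A α) (X.monomial α) ξ) ξ)) := by
    intro α
    rw [← (hsum α).tsum_eq]
    have := tendsto_tsum_of_dominated_convergence
      (𝓕 := (Filter.atTop : Filter (Finset (MultiWord n))))
      (f := fun s β => if β ∈ s ∧ α * β ∈ s then
        inner ℂ (tensorOp (A α) 1 (u β)) (u (α * β)) else 0)
      (g := fun β => inner ℂ (tensorOp (A α) 1 (u β)) (u (α * β))) (hsum α).summable.norm
      (fun β => by
        refine tendsto_const_nhds.congr' ?_
        filter_upwards [Filter.eventually_ge_atTop {β, α * β}] with s hs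
        rw [if_pos ⟨hs (by simp), hs (by simp)⟩])
      (Filter.Eventually.of_forall fun s β => by
        split_ifs
        · exact le_rfl
        · simp)
    refine this.congr fun s => ?_
    rw [tsum_eq_sum (s := s) (fun β hβ => if_neg fun h => hβ h.1)]
    exact Finset.sum_congr rfl fun β hβ => by simp [hβ]
  have hlim := (tendsto_finsetSum (Gam n q) fun α _ => htrunc α).norm
  have hT : inner ℂ (homPart A X q ξ) ξ =
      ∑ α ∈ Gam n q, inner ℂ (tensorOp (A α) (X.monomial α) ξ) ξ := by
    rw [homPart, sum_apply, sum_inner]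
  rw [hT]
  -- each truncated form is bounded by the ampliated form of the universal model
  refine le_of_tendsto hlim (Filter.Eventually.of_forall fun s => ?_)
  refine (norm_shiftForm_ampliation_le A q s u).trans
    (mul_le_of_le_one_right (numericalRadius_nonneg _) ?_)
  simpa [hξ] using (summable_norm_sq_poissonComp hX hD ξ).2 s

end NCPolyball

end

theorem mainTheorem7 {k : ℕ} (n : Fin k → ℕ)
    {K : Type*} [NormedAddCommGroup K] [InnerProductSpace ℂ K] [CompleteSpace K]
    (m : ℕ∞) (A₀ : K →L[ℂ] K) (A : NCPolyball.MultiWord n → (K →L[ℂ] K))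
    (f : NCPolyball.FreeFunction n K)
    (hf : NCPolyball.IsFreePluriharmonic f)
    (hpos : NCPolyball.IsPositiveOnPolyball f)
    (hexp : NCPolyball.HasHomogeneousExpansion f m A₀ A) :
    (∀ q : ℕ, 1 ≤ q → (q : ℕ∞) ≤ m →
      ∀ (H : Type*) [NormedAddCommGroup H] [InnerProductSpace ℂ H] [CompleteSpace H],
        ∀ X ∈ NCPolyball.regularPolyball n H,
          NCPolyball.numericalRadius (NCPolyball.homPart A X q) ≤
            NCPolyball.numericalRadius
              (NCPolyball.homPart A (NCPolyball.universalModel n) q)) ∧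
    (∀ M : ℕ, m = (M : ℕ∞) → ∀ q : ℕ, 1 ≤ q → q ≤ M →
      NCPolyball.numericalRadius (NCPolyball.homPart A (NCPolyball.universalModel n) q) ≤
        ‖A₀‖ * Real.cos (Real.pi / (((M / q : ℕ) : ℝ) + 2))) ∧
    (m = ⊤ → ∀ q : ℕ, 1 ≤ q →
      NCPolyball.numericalRadius (NCPolyball.homPart A (NCPolyball.universalModel n) q) ≤
        ‖A₀‖) := by
  refine ⟨fun q _ _ H _ _ _ X hX => NCPolyball.numericalRadius_homPart_le A hX q, ?_, ?_⟩
  · rintro M rfl q hq hqM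
    exact NCPolyball.numericalRadius_homPart_universalModel_le_cos hpos hexp hq hqM
  · rintro rfl q hq
    exact NCPolyball.numericalRadius_homPart_universalModel_le hpos hexp hq
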